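/- Let $U$ be a complex manifold and let $Y\subset U$ be a smooth irreducible (that is, connected and non-empty) compact complex hypersurface with ideal sheaf $I\subset\mathcal O_U$. For $\ell\ge 0$ let $Y(\ell)$ be the $\ell$-th infinitesimal neighbourhood, with structure sheaf $\mathcal O_U/I^{\ell+1}$, and let $Y(\infty)$ be the formal completion of $U$ along $Y$. Assume that the normal bundle $NY=\mathcal O_U(Y)_{|Y}$ carries a flat unitary connection, and let $F$ be a flat unitary line bundle on a neighbourhood of $Y$ in $U$ (given by locally constant transition functions of modulus one) such that $F_{|Y}\simeq NY$ as holomorphic line bundles. Let $\mathcal U=\mathcal O_U(Y)\otimes F^*$ be the Ueda line bundle. The Ueda type $\mathrm{utype}(Y)\in\mathbb N\cup\{\infty\}$ is the least $\ell\geq 0$ such that $\mathcal U_{|Y(\ell)}\not\simeq\mathcal O_{Y(\ell)}$, and $\infty$ if there is no such $\ell$. Let $k\ge 1$ be an integer and let $$\hat\omega\in H^0\bigl(Y(\infty),\Omega^1_{Y(\infty)}((k+1)Y)\bigr)=\varprojlim_{\ell}H^0\bigl(Y,\ \Omega^1_U((k+1)Y)/I^{\ell+1}\Omega^1_U((k+1)Y)\bigr)$$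 be a closed formal meromorphic $1$-form on $Y(\infty)$ with poles of order exactly $k+1$ on $Y$, that is, $\hat\omega$ is not a section of $\Omega^1_{Y(\infty)}(kY)$. Then $\mathrm{utype}(Y)\ge k$, and the order of $NY$ in $\mathrm{Pic}(Y)$ is finite and divides $k$. -/

import Mathlib

open scoped Manifold ContDiff Topology

noncomputable section

namespace Ueda

variable {E : Type*} [NormedAddCommGroup E] [NormedSpace ℂ E]
  {U : Type*} [TopologicalSpace U] [ChartedSpace E U]

/-! ### Holomorphic germs, smooth hypersurfaces, powers of the ideal sheaf -/

/-- `f` is holomorphic in a neighbourhood of `p` (complex analytic in a chart at `p`). -/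
def HolAt (E : Type*) [NormedAddCommGroup E] [NormedSpace ℂ E]
    {U : Type*} [TopologicalSpace U] [ChartedSpace E U] (f : U → ℂ) (p : U) : Prop :=
  ContMDiffAt 𝓘(ℂ, E) 𝓘(ℂ, ℂ) ω f p

/-- `y` is a reduced local equation of `Y` at `p`: a holomorphic submersion near `p` whose zero
set is `Y`. -/
structure IsLocalEquation (E : Type*) [NormedAddCommGroup E] [NormedSpace ℂ E]
    {U : Type*} [TopologicalSpace U] [ChartedSpace E U]
    (Y : Set U) (y : U → ℂ) (p : U) : Prop where
  hol : HolAt E y p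
  submersion : mfderiv 𝓘(ℂ, E) 𝓘(ℂ, ℂ) y p ≠ 0
  zeros : ∀ᶠ q in 𝓝 p, q ∈ Y ↔ y q = 0

/-- `Y` is a smooth complex hypersurface of `U`. -/
structure IsSmoothHypersurface (E : Type*) [NormedAddCommGroup E] [NormedSpace ℂ E]
    {U : Type*} [TopologicalSpace U] [ChartedSpace E U] (Y : Set U) : Prop where
  isClosed : IsClosed Y
  exists_equation : ∀ p ∈ Y, ∃ y : U → ℂ, IsLocalEquation E Y y p

/-- For `p ∈ Y`, the germ of `f` at `p` belongs to `I ^ m`, where `I` is the ideal sheaf of `Y`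
(which is generated near `p` by any local equation). Equality in the structure sheaf
`𝒪_U / I ^ (ℓ + 1)` of the infinitesimal neighbourhood `Y(ℓ)` is congruence modulo `I ^ (ℓ + 1)`. -/
def MemIdealPow (E : Type*) [NormedAddCommGroup E] [NormedSpace ℂ E]
    {U : Type*} [TopologicalSpace U] [ChartedSpace E U]
    (Y : Set U) (m : ℕ) (f : U → ℂ) (p : U) : Prop :=
  ∃ y g : U → ℂ, IsLocalEquation E Y y p ∧ HolAt E g p ∧ f =ᶠ[𝓝 p] fun q => y q ^ m * g q

/-! ### Line bundles near `Y` and their restrictions to infinitesimal neighbourhoods -/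

/-- A holomorphic line bundle on a neighbourhood of `Y` in `U` (as a germ along `Y`), given by
transition functions `g p q` for a covering of `Y` by open subsets `nhd p` of `U`.
There is no loss of generality in indexing the covering by the points of `Y`. -/
structure LineBundle (E : Type*) [NormedAddCommGroup E] [NormedSpace ℂ E]
    {U : Type*} [TopologicalSpace U] [ChartedSpace E U] (Y : Set U) where
  nhd : Y → Set U
  isOpen_nhd : ∀ p, IsOpen (nhd p)
  mem_nhd : ∀ p : Y, (p : U) ∈ nhd p
  g : Y → Y → U → ℂ
  hol : ∀ p q, ∀ r ∈ Y ∩ nhd p ∩ nhd q, HolAt E (g p q) r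
  ne_zero : ∀ p q, ∀ r ∈ Y ∩ nhd p ∩ nhd q, g p q r ≠ 0
  cocycle : ∀ p q s, ∀ r ∈ Y ∩ nhd p ∩ nhd q ∩ nhd s,
    ∀ᶠ x in 𝓝 r, g p s x = g p q x * g q s x

namespace LineBundle

variable {Y : Set U}

/-- Tensor product of line bundles. -/
def tensor (L M : LineBundle E Y) : LineBundle E Y where
  nhd p := L.nhd p ∩ M.nhd p
  isOpen_nhd p := (L.isOpen_nhd p).inter (M.isOpen_nhd p)
  mem_nhd p := ⟨L.mem_nhd p, M.mem_nhd p⟩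
  g p q x := L.g p q x * M.g p q x
  hol p q r hr := ContMDiffAt.mul (L.hol p q r ⟨⟨hr.1.1, hr.1.2.1⟩, hr.2.1⟩)
    (M.hol p q r ⟨⟨hr.1.1, hr.1.2.2⟩, hr.2.2⟩)
  ne_zero p q r hr := mul_ne_zero (L.ne_zero p q r ⟨⟨hr.1.1, hr.1.2.1⟩, hr.2.1⟩)
    (M.ne_zero p q r ⟨⟨hr.1.1, hr.1.2.2⟩, hr.2.2⟩)
  cocycle p q s r hr := by
    filter_upwards [L.cocycle p q s r ⟨⟨⟨hr.1.1.1, hr.1.1.2.1⟩, hr.1.2.1⟩, hr.2.1⟩,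
      M.cocycle p q s r ⟨⟨⟨hr.1.1.1, hr.1.1.2.2⟩, hr.1.2.2⟩, hr.2.2⟩] with x h1 h2
    rw [h1, h2]
    ring

/-- Dual line bundle. -/
def dual (L : LineBundle E Y) : LineBundle E Y where
  nhd := L.nhd
  isOpen_nhd := L.isOpen_nhd
  mem_nhd := L.mem_nhd
  g p q x := (L.g p q x)⁻¹
  hol p q r hr := ContMDiffAt.inv₀ (L.hol p q r hr) (L.ne_zero p q r hr)
  ne_zero p q r hr := inv_ne_zero (L.ne_zero p q r hr)
  cocycle p q s r hr := by
    filter_upwards [L.cocycle p q s r hr] with x h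
    rw [h, mul_inv]

/-- Tensor power `L ^ ⊗ m`. -/
def pow (L : LineBundle E Y) (m : ℕ) : LineBundle E Y where
  nhd := L.nhd
  isOpen_nhd := L.isOpen_nhd
  mem_nhd := L.mem_nhd
  g p q x := L.g p q x ^ m
  hol p q r hr := ContMDiffAt.pow (L.hol p q r hr) m
  ne_zero p q r hr := pow_ne_zero m (L.ne_zero p q r hr)
  cocycle p q s r hr := by
    filter_upwards [L.cocycle p q s r hr] with x h
    rw [h, mul_pow]

/-- The restriction of `L` to the infinitesimal neighbourhood `Y(ℓ) = Spec (𝒪_U / I ^ (ℓ + 1))` is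
isomorphic to the trivial line bundle: after refining the covering, the transition functions are
of the form `h p / h q` modulo `I ^ (ℓ + 1)`, with `h p` invertible holomorphic functions. -/
def TrivialOn (L : LineBundle E Y) (ℓ : ℕ) : Prop :=
  ∃ (W : Y → Set U) (h : Y → U → ℂ),
    (∀ p, IsOpen (W p) ∧ (p : U) ∈ W p ∧ W p ⊆ L.nhd p) ∧
    (∀ p, ∀ r ∈ Y ∩ W p, HolAt E (h p) r ∧ h p r ≠ 0) ∧
    ∀ p q, ∀ r ∈ Y ∩ W p ∩ W q,
      MemIdealPow E Y (ℓ + 1) (fun x => L.g p q x * h q x - h p x) r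

/-- The restrictions of `L` and `M` to `Y = Y(0)` are isomorphic as holomorphic line bundles. -/
def IsoOnY (L M : LineBundle E Y) : Prop :=
  (L.tensor M.dual).TrivialOn 0

/-- The order of the restriction of `L` to `Y = Y(0)` in the Picard group of `Y`: the least `m ≥ 1`
such that `L ^ ⊗ m` is trivial on `Y`, and `0` if there is none (infinite order). -/
def orderOnY (L : LineBundle E Y) : ℕ :=
  sInf {m : ℕ | 0 < m ∧ (L.pow m).TrivialOn 0}

/-- `L` is flat and unitary: its transition functions are locally constant, of modulus one. -/
def IsFlatUnitary (L : LineBundle E Y) : Prop :=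
  ∀ p q, ∀ r ∈ Y ∩ L.nhd p ∩ L.nhd q, ∃ c : ℂ, ‖c‖ = 1 ∧ ∀ᶠ x in 𝓝 r, L.g p q x = c

/-- `L` is the line bundle `𝒪_U(Y)`: its transition functions are the quotients `y p / y q` of
local equations of `Y`. Its restriction to `Y` is the normal bundle `NY`. -/
def IsDivisorBundle (L : LineBundle E Y) : Prop :=
  ∃ y : Y → U → ℂ, (∀ p, ∀ r ∈ Y ∩ L.nhd p, IsLocalEquation E Y (y p) r) ∧
    ∀ p q, ∀ r ∈ Y ∩ L.nhd p ∩ L.nhd q, ∀ᶠ x in 𝓝 r, y p x = L.g p q x * y q x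

end LineBundle

/-- The Ueda line bundle `𝒪_U(Y) ⊗ F^*`, where `D = 𝒪_U(Y)` and `F` is the flat unitary extension
of the normal bundle to a neighbourhood of `Y`. -/
def uedaBundle {Y : Set U} (D F : LineBundle E Y) : LineBundle E Y :=
  D.tensor F.dual

/-- The Ueda type of `Y`: the least `ℓ` such that the Ueda line bundle is not trivial on `Y(ℓ)`,
and `⊤` if there is none. -/
def uedaType {Y : Set U} (D F : LineBundle E Y) : ℕ∞ :=
  sInf ((fun ℓ : ℕ => (ℓ : ℕ∞)) '' {ℓ : ℕ | ¬ (uedaBundle D F).TrivialOn ℓ})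

/-! ### Formal meromorphic one-forms on the completion `Y(∞)` -/

/-- A field of complex linear forms on the tangent spaces of `U`. -/
abbrev OneForm (E : Type*) [NormedAddCommGroup E] [NormedSpace ℂ E]
    (U : Type*) [TopologicalSpace U] [ChartedSpace E U] :=
  ∀ q : U, TangentSpace 𝓘(ℂ, E) q →L[ℂ] ℂ

/-- The expression of a one-form in the chart at `r` (pullback by the inverse of the chart). -/
def chartForm (α : OneForm E U) (r : U) (x : E) : E →L[ℂ] ℂ :=
  (α ((chartAt E r).symm x)).comp (mfderiv 𝓘(ℂ, E) 𝓘(ℂ, E) (chartAt E r).symm x)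

/-- The expression of the exterior derivative `dα` in the chart at `r`, as the alternating bilinear
form `dα(v, w) = (D_v α)(w) - (D_w α)(v)`. -/
def chartExtDeriv (α : OneForm E U) (r : U) (x : E) : E →L[ℂ] E →L[ℂ] ℂ :=
  fderiv ℂ (chartForm α r) x - (fderiv ℂ (chartForm α r) x).flip

/-- Let `A` be a map defined on the domain of the chart at `r ∈ Y` (the coefficients of a tensor
field). It is holomorphic off `Y` and has order at least `n ∈ ℤ` along `Y` near `r`: it is
`y ^ n` times a holomorphic map. -/
def OrderGE {F : Type*} [NormedAddCommGroup F] [NormedSpace ℂ F]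
    (Y : Set U) (n : ℤ) (r : U) (A : E → F) : Prop :=
  ∃ (y : U → ℂ) (θ : E → F), IsLocalEquation E Y y r ∧ AnalyticAt ℂ θ (chartAt E r r) ∧
    ∀ᶠ x in 𝓝 (chartAt E r r), (chartAt E r).symm x ∉ Y →
      A x = y ((chartAt E r).symm x) ^ n • θ x

/-- A global section of `Ω¹_{Y(∞)}(mY)`, the formal completion along `Y` of the sheaf
`Ω¹_U(mY)` of meromorphic one-forms with poles of order at most `m` on `Y`.
It is a compatible system, for `ℓ = 0, 1, 2, …`, of global sections of
`Ω¹_U(mY) / I ^ (ℓ + 1) Ω¹_U(mY)`; the `ℓ`-th section is represented on an open neighbourhood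
`nhd ℓ p` of each point `p` of `Y` by a meromorphic one-form `form ℓ p`. -/
structure FormalForm (E : Type*) [NormedAddCommGroup E] [NormedSpace ℂ E]
    {U : Type*} [TopologicalSpace U] [ChartedSpace E U] (Y : Set U) (m : ℕ) where
  nhd : ℕ → Y → Set U
  isOpen_nhd : ∀ ℓ p, IsOpen (nhd ℓ p)
  mem_nhd : ∀ ℓ, ∀ p : Y, (p : U) ∈ nhd ℓ p
  form : ℕ → Y → OneForm E U
  pole_le : ∀ ℓ p, ∀ r ∈ Y ∩ nhd ℓ p, OrderGE Y (-(m : ℤ)) r (chartForm (form ℓ p) r)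
  compat : ∀ ℓ ℓ', ℓ ≤ ℓ' → ∀ p p', ∀ r ∈ Y ∩ nhd ℓ p ∩ nhd ℓ' p',
    OrderGE Y ((ℓ : ℤ) + 1 - m) r
      (fun x => chartForm (form ℓ p) r x - chartForm (form ℓ' p') r x)

/-- The formal form is closed: its exterior derivative, which is a section of the completion of
`Ω²_U((m + 1)Y)`, vanishes modulo `I ^ (ℓ + 1) Ω²_U((m + 1)Y)` for every `ℓ`. -/
def FormalForm.IsClosed {Y : Set U} {m : ℕ} (α : FormalForm E Y m) : Prop :=
  ∀ ℓ p, ∀ r ∈ Y ∩ α.nhd ℓ p,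
    OrderGE Y ((ℓ : ℤ) + 1 - ((m : ℤ) + 1)) r (chartExtDeriv (α.form ℓ p) r)

/-- The formal form has poles of order exactly `m` on `Y`: it is not a section of
`Ω¹_{Y(∞)}((m - 1)Y)`, that is, its class modulo `I · Ω¹_U(mY)` is not identically zero. -/
def FormalForm.HasExactPoleOrder {Y : Set U} {m : ℕ} (α : FormalForm E Y m) : Prop :=
  ∃ p : Y, ¬ OrderGE Y (1 - (m : ℤ)) (p : U) (chartForm (α.form 0 p) (p : U))

end Ueda

end

/-!
Write a closed form with poles of order `k + 1` along `Y` locally as `d (f / y ^ k)` plus a form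
with at most a simple pole, where `y` is the local equation of `Y` that defines the transition
functions `g` of `𝒪(Y)`. Such an `f` exists because closedness forces the leading coefficient to be
a multiple of `dy` along `Y`, so that an exact form can be subtracted to lower the pole order
(`IsEquationAt.exists_primitive`); it is unique modulo `y ^ k` because the derivative of a function
with a pole has at least a double pole (`IsEquationAt.exists_eq_pow_mul`). Comparing two local
primitives one finds `f p = g p q ^ k * f q` modulo `I ^ k`: the leading coefficient is a section of
`𝒪(Y) ^ k` over `Y(k - 1)`, and it does not vanish identically on `Y` since the pole order is exact
(`FormalForm.exists_leading_section`). The form only enters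
through its truncation at level `k`, which determines the pole order as well.

Let `h` be the isomorphism between `NY` and the flat unitary bundle `F` on `Y`. Then `f / h ^ k` is
a section of the flat unitary bundle `F ^ k` on `Y`. Its norm is a function on the compact connected
manifold `Y`, so by the maximum principle it is constant, and `f / h ^ k` is locally constant in the
flat frames (`norm_eq_const_of_flat_section`). Hence `f` has no zeros on `Y`, and it trivializes
`NY ^ k`. Moreover the function `h * exp (log (f / (κ h ^ k)) / k)`, where `κ` is the constant value
of `f / h ^ k` on `Y`, is a `k`-th root of `f / κ` which extends `h` from `Y`. As `f` satisfies the
cocycle relation modulo `I ^ k`, and `k`-th roots of units are unique modulo `I ^ k` once their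
values are fixed, this root trivializes the Ueda bundle on `Y(k - 1)` (`trivialOn_of_section`).

That a holomorphic map vanishing on `Y` is divisible by the local equation is Hadamard's lemma,
which is obtained by telescoping the terms of the power series (`exists_analyticAt_sub_comp_kerProj`), in
coordinates that straighten the hypersurface (`IsEquationAt.exists_straightening`).
-/

noncomputable section

namespace Ueda

/-! ### Division by a linear form -/

section Division

variable {E : Type*} [NormedAddCommGroup E] [NormedSpace ℂ E]
  {F : Type*} [NormedAddCommGroup F] [NormedSpace ℂ F]

/-- The projection onto the kernel of a linear form `L` along a vector `v` with `L v = 1`. -/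
def kerProj (L : E →L[ℂ] ℂ) (v : E) : E →L[ℂ] E :=
  ContinuousLinearMap.id ℂ E - L.smulRight v

theorem kerProj_apply (L : E →L[ℂ] ℂ) (v x : E) : kerProj L v x = x - L x • v := rfl

theorem apply_kerProj {L : E →L[ℂ] ℂ} {v : E} (hv : L v = 1) (x : E) : L (kerProj L v x) = 0 := by
  simp [kerProj_apply, hv]

theorem kerProj_eq_self {L : E →L[ℂ] ℂ} {x : E} (v : E) (hx : L x = 0) : kerProj L v x = x := by
  simp [kerProj_apply, hx]

/-- If `∑ pₙ(hⁿ)` is the Taylor series of `f`, then this is the Taylor series of the quotient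
of `f - f ∘ π` by `L`, where `π` is the projection onto `ker L` along `v`: one has
`pₙ₊₁(h, …, h) - pₙ₊₁(π h, …, π h) = L h • ∑ j, pₙ₊₁(π h, …, π h, v, h, …, h)`, with `v` at the
`j`-th place. -/
def quotSeries (p : FormalMultilinearSeries ℂ E F) (L : E →L[ℂ] ℂ) (v : E) :
    FormalMultilinearSeries ℂ E F := fun n =>
  ∑ j : Fin (n + 1), ((p (n + 1)).curryMid j v).compContinuousLinearMap
    fun i => if i.castSucc < j then kerProj L v else ContinuousLinearMap.id ℂ E

theorem smul_quotSeries_apply (p : FormalMultilinearSeries ℂ E F) (L : E →L[ℂ] ℂ) (v h : E)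
    (n : ℕ) : L h • quotSeries p L v n (fun _ => h) =
      p (n + 1) (fun _ => h) - p (n + 1) (fun _ => kerProj L v h) := by
  set b : ℕ → Fin (n + 1) → E := fun j i => if (i : ℕ) < j then kerProj L v h else h with hb
  have key : ∀ j : Fin (n + 1), L h • ((p (n + 1)).curryMid j v).compContinuousLinearMap
      (fun i => if i.castSucc < j then kerProj L v else ContinuousLinearMap.id ℂ E) (fun _ => h)
      = p (n + 1) (b j) - p (n + 1) (b (j + 1)) := by
    intro j
    have h1 : b j = Function.update (b j) j h := by
      ext i; by_cases hi : i = j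
      · subst hi; simp [hb]
      · simp [hi]
    have h2 : b (j + 1) = Function.update (b j) j (kerProj L v h) := by
      ext i; by_cases hi : i = j
      · subst hi; simp [hb]
      · have : (i : ℕ) ≠ j := fun h => hi (Fin.ext h)
        have h3 : (i : ℕ) < j + 1 ↔ (i : ℕ) < j := by omega
        simp [hi, hb, h3]
    have h3 : p (n + 1) (b j) - p (n + 1) (b (j + 1)) =
        p (n + 1) (Function.update (b j) j (h - kerProj L v h)) := by
      rw [ContinuousMultilinearMap.map_update_sub, ← h1, ← h2]
    rw [h3, kerProj_apply, sub_sub_cancel, ContinuousMultilinearMap.map_update_smul,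
      ContinuousMultilinearMap.compContinuousLinearMap_apply,
      ContinuousMultilinearMap.curryMid_apply]
    congr 2
    ext i
    refine Fin.succAboveCases j ?_ (fun i => ?_) i
    · simp
    · simp only [Fin.insertNth_apply_succAbove, ne_eq, Fin.succAbove_ne, not_false_eq_true,
        Function.update_of_ne, hb]
      by_cases hi : i.castSucc < j
      · have h4 : ((j.succAbove i : Fin (n + 1)) : ℕ) < j := by
          rw [Fin.succAbove_of_castSucc_lt _ _ hi]; exact hi
        simp [hi, h4]
      · have h4 : ¬ ((j.succAbove i : Fin (n + 1)) : ℕ) < j := by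
          rw [Fin.succAbove_of_le_castSucc _ _ (not_lt.1 hi)]
          have := not_lt.1 hi
          rw [Fin.le_def] at this
          simp at this ⊢; omega
        simp [hi, h4]
  rw [quotSeries, sum_apply, Finset.smul_sum,
    Finset.sum_congr rfl (fun j _ => key j),
    Fin.sum_univ_eq_sum_range (fun j => p (n + 1) (b j) - p (n + 1) (b (j + 1))) (n + 1),
    Finset.sum_range_sub']
  have hb0 : b 0 = fun _ => h := by ext i; simp [hb]
  have hb1 : b (n + 1) = fun _ => kerProj L v h := by ext i; simp [hb, i.2]
  rw [hb0, hb1]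

theorem norm_quotSeries_le (p : FormalMultilinearSeries ℂ E F) (L : E →L[ℂ] ℂ) (v : E) (n : ℕ) :
    ‖quotSeries p L v n‖ ≤ (n + 1) * (‖p (n + 1)‖ * ‖v‖ * (max 1 ‖kerProj L v‖) ^ n) := by
  have : ∀ j : Fin (n + 1), ‖((p (n + 1)).curryMid j v).compContinuousLinearMap
      (fun i => if i.castSucc < j then kerProj L v else ContinuousLinearMap.id ℂ E)‖ ≤
      ‖p (n + 1)‖ * ‖v‖ * (max 1 ‖kerProj L v‖) ^ n := by
    intro j
    refine (ContinuousMultilinearMap.norm_compContinuousLinearMap_le _ _).trans ?_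
    gcongr
    · calc _ ≤ ‖(p (n + 1)).curryMid j‖ * ‖v‖ := ContinuousLinearMap.le_opNorm _ _
        _ = _ := by rw [ContinuousMultilinearMap.norm_curryMid]
    · calc _ ≤ ∏ i : Fin n, max 1 ‖kerProj L v‖ := by
            refine Finset.prod_le_prod (fun _ _ => norm_nonneg _) fun i _ => ?_
            split_ifs
            · exact le_max_right _ _
            · exact ContinuousLinearMap.norm_id_le.trans (le_max_left _ _)
        _ = _ := by simp
  refine (norm_sum_le _ _).trans ((Finset.sum_le_sum fun j _ => this j).trans ?_)
  simp

theorem quotSeries_radius_pos {p : FormalMultilinearSeries ℂ E F} (hp : 0 < p.radius)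
    (L : E →L[ℂ] ℂ) (v : E) : 0 < (quotSeries p L v).radius := by
  obtain ⟨r, hr0, hr⟩ := ENNReal.lt_iff_exists_nnreal_btwn.1 hp
  obtain ⟨K, hK, hpK⟩ := p.norm_mul_pow_le_of_lt_radius hr
  have hr0' : (0 : ℝ) < r := by exact_mod_cast hr0
  set C : ℝ := max 1 ‖kerProj L v‖ with hC
  have hC1 : 1 ≤ C := le_max_left _ _
  set s : NNReal := r / (2 * C.toNNReal) with hs
  have hsr : (s : ℝ) = r / (2 * C) := by
    simp [hs, Real.coe_toNNReal C (by positivity)]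
  have hs0 : 0 < s := by
    rw [← NNReal.coe_pos, hsr]; positivity
  refine lt_of_lt_of_le (ENNReal.coe_pos.2 hs0)
    ((quotSeries p L v).le_radius_of_bound (K / r * ‖v‖) fun n => ?_)
  have h2 : ((n : ℝ) + 1) ≤ 2 ^ n := by
    exact_mod_cast (Nat.lt_two_pow_self (n := n))
  calc ‖quotSeries p L v n‖ * (s : ℝ) ^ n
      ≤ ((n + 1) * (‖p (n + 1)‖ * ‖v‖ * C ^ n)) * (s : ℝ) ^ n := by
        gcongr; exact norm_quotSeries_le p L v n
    _ = ((n + 1) / 2 ^ n) * ((‖p (n + 1)‖ * r ^ (n + 1)) / r * ‖v‖) := by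
        rw [hsr, div_pow, mul_pow, pow_succ]; field_simp
    _ ≤ 1 * (K / r * ‖v‖) := by
        gcongr
        · rw [div_le_one (by positivity)]; exact h2
        · exact hpK _
    _ = _ := one_mul _

/-- Hadamard's lemma: the increment of an analytic map in the direction transverse to the
hyperplane `ker L` is divisible by `L`. -/
theorem exists_analyticAt_sub_comp_kerProj [CompleteSpace F] {f : E → F} {x₀ : E}
    (hf : AnalyticAt ℂ f x₀) {L : E →L[ℂ] ℂ} (hx₀ : L x₀ = 0) (v : E) :
    ∃ g : E → F, AnalyticAt ℂ g x₀ ∧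
      ∀ᶠ x in 𝓝 x₀, f x - f (kerProj L v x) = L x • g x := by
  obtain ⟨p, hp⟩ := hf
  have hq := quotSeries_radius_pos hp.radius_pos L v
  set q := quotSeries p L v
  have hqs := (q.hasFPowerSeriesOnBall hq).hasFPowerSeriesAt
  have hsub : Filter.Tendsto (fun x => x - x₀) (𝓝 x₀) (𝓝 0) := by
    have : ContinuousAt (fun x : E => x - x₀) x₀ := by fun_prop
    simpa [ContinuousAt] using this
  have hproj : Filter.Tendsto (fun x => kerProj L v (x - x₀)) (𝓝 x₀) (𝓝 0) := by
    have := ((kerProj L v).continuous.tendsto 0).comp hsub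
    rwa [map_zero] at this
  refine ⟨fun x => q.sum (x - x₀), ?_, ?_⟩
  · have h1 : AnalyticAt ℂ q.sum (x₀ - x₀) := by rw [sub_self]; exact hqs.analyticAt
    exact AnalyticAt.fun_comp h1 (f := fun x => x - x₀) (analyticAt_id.sub analyticAt_const)
  · have e1 := hsub.eventually hqs.eventually_hasSum
    have e2 := hsub.eventually hp.eventually_hasSum
    have e3 := hproj.eventually hp.eventually_hasSum
    filter_upwards [e1, e2, e3] with x h1 h2 h3
    have e4 : x₀ + kerProj L v (x - x₀) = kerProj L v x := by
      rw [kerProj_apply, kerProj_apply, map_sub, hx₀, sub_zero]; abel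
    have e5 : L (x - x₀) = L x := by simp [hx₀]
    rw [e4] at h3
    rw [add_sub_cancel] at h2
    rw [zero_add] at h1
    have h4 := (hasSum_nat_add_iff' 1).2 (h2.sub h3)
    have h5 := h1.const_smul (L (x - x₀))
    simp only [q, smul_quotSeries_apply] at h5
    have h6 := h4.unique h5
    rw [e5] at h6
    rw [← h6]
    have : p 0 (fun _ => x - x₀) = p 0 (fun _ => kerProj L v (x - x₀)) := by
      congr 1; ext i; exact i.elim0
    simp [this]

end Division

/-! ### Hypersurfaces and polar parts in a vector space -/

section LocalEquation

variable {E : Type*} [NormedAddCommGroup E] [NormedSpace ℂ E]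
  {F : Type*} [NormedAddCommGroup F] [NormedSpace ℂ F]

/-- `y` is a reduced local equation at `x₀` of the hypersurface `{y = 0}` of the vector space `E`:
a holomorphic submersion at `x₀` that vanishes at `x₀`. -/
structure IsEquationAt (y : E → ℂ) (x₀ : E) : Prop where
  analyticAt : AnalyticAt ℂ y x₀
  apply_eq_zero : y x₀ = 0
  fderiv_ne_zero : fderiv ℂ y x₀ ≠ 0

namespace IsEquationAt

variable {y : E → ℂ} {x₀ : E}

theorem exists_transverse (hy : IsEquationAt y x₀) : ∃ v : E, fderiv ℂ y x₀ v = 1 := by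
  obtain ⟨w, hw⟩ : ∃ w, fderiv ℂ y x₀ w ≠ 0 := by
    by_contra! h
    exact hy.fderiv_ne_zero (ContinuousLinearMap.ext h)
  exact ⟨(fderiv ℂ y x₀ w)⁻¹ • w, by simp [hw]⟩

theorem eventually_fderiv_apply_ne_zero (hy : IsEquationAt y x₀) {v : E}
    (hv : fderiv ℂ y x₀ v = 1) : ∀ᶠ x in 𝓝 x₀, fderiv ℂ y x v ≠ 0 := by
  have h : ContinuousAt (fun x => fderiv ℂ y x v) x₀ :=
    (hy.analyticAt.fderiv.continuousAt).clm_apply continuousAt_const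
  exact h.eventually_ne (by rw [hv]; exact one_ne_zero)

theorem eventually_of_apply_eq_zero (hy : IsEquationAt y x₀) :
    ∀ᶠ x in 𝓝 x₀, y x = 0 → IsEquationAt y x := by
  filter_upwards [hy.analyticAt.eventually_analyticAt,
    hy.analyticAt.fderiv.continuousAt.eventually_ne hy.fderiv_ne_zero] with x h1 h2 h3
  exact ⟨h1, h3, h2⟩

/-- The complement of a hypersurface is dense. -/
theorem frequently_ne_zero (hy : IsEquationAt y x₀) : ∃ᶠ x in 𝓝 x₀, y x ≠ 0 := by
  intro h
  have h' : y =ᶠ[𝓝 x₀] fun _ => 0 := by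
    filter_upwards [h] with x hx using not_not.1 hx
  exact hy.fderiv_ne_zero (by rw [h'.fderiv_eq]; simp)

theorem eventually_eq_of_continuousAt {G : Type*} [NormedAddCommGroup G]
    (hy : IsEquationAt y x₀) {f g : E → G}
    (hf : ∀ᶠ x in 𝓝 x₀, ContinuousAt f x) (hg : ∀ᶠ x in 𝓝 x₀, ContinuousAt g x)
    (h : ∀ᶠ x in 𝓝 x₀, y x ≠ 0 → f x = g x) : ∀ᶠ x in 𝓝 x₀, f x = g x := by
  filter_upwards [hf, hg, h.eventually_nhds, h, hy.eventually_of_apply_eq_zero]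
    with x hfx hgx hx hx' hyx
  by_cases h0 : y x = 0
  · have hc : ContinuousAt (fun z => f z - g z) x := hfx.sub hgx
    by_contra hne
    have h1 := hc.eventually_ne (sub_ne_zero.2 hne)
    obtain ⟨z, hz0, hz1, hz2⟩ := ((hyx h0).frequently_ne_zero.and_eventually (h1.and hx)).exists
    exact hz1 (sub_eq_zero.2 (hz2 hz0))
  · exact hx' h0

/-- Two holomorphic maps that agree off a hypersurface agree. -/
theorem eventually_eq (hy : IsEquationAt y x₀) [CompleteSpace F] {f g : E → F}
    (hf : AnalyticAt ℂ f x₀) (hg : AnalyticAt ℂ g x₀)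
    (h : ∀ᶠ x in 𝓝 x₀, y x ≠ 0 → f x = g x) : ∀ᶠ x in 𝓝 x₀, f x = g x :=
  hy.eventually_eq_of_continuousAt hf.eventually_continuousAt hg.eventually_continuousAt h

/-- Straightening of a hypersurface: in suitable local coordinates `Ψ`, with inverse `Φ`, the
equation `y` becomes a linear form `L`. -/
theorem exists_straightening [CompleteSpace E] (hy : IsEquationAt y x₀) :
    ∃ (Ψ Φ : E → E) (L : E →L[ℂ] ℂ) (v : E), L v = 1 ∧ AnalyticAt ℂ Ψ x₀ ∧
      AnalyticAt ℂ Φ (Ψ x₀) ∧ (∀ x, L (Ψ x) = y x) ∧ (∀ᶠ x in 𝓝 x₀, Φ (Ψ x) = x) ∧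
      ∀ᶠ z in 𝓝 (Ψ x₀), Ψ (Φ z) = z := by
  obtain ⟨v, hv⟩ := hy.exists_transverse
  set L := fderiv ℂ y x₀ with hL
  -- as `L v = 1`, this map carries `y` to `L`; its derivative at `x₀` is the identity
  have hΨ : AnalyticAt ℂ (fun x => x + (y x - L x) • v) x₀ :=
    analyticAt_id.add ((hy.analyticAt.sub (L.analyticAt _)).smul analyticAt_const)
  have hd : HasFDerivAt (fun x => x + (y x - L x) • v)
      ((ContinuousLinearEquiv.refl ℂ E : E ≃L[ℂ] E) : E →L[ℂ] E) x₀ := by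
    have h1 := ((hasFDerivAt_id (𝕜 := ℂ) x₀).add
      ((hy.analyticAt.differentiableAt.hasFDerivAt.sub L.hasFDerivAt).smul_const v))
    convert! h1 using 1
    ext w
    simp [hL]
  have hs := hΨ.contDiffAt (n := ω)
  have hω : (ω : WithTop ℕ∞) ≠ 0 := by simp
  refine ⟨_, hs.localInverse hd hω, L, v, hv, hΨ,
    (hs.to_localInverse hd hω).analyticAt, ?_, ?_, ?_⟩
  · intro x
    simp [hv]
  · exact (hs.hasStrictFDerivAt' hd hω).eventually_left_inverse
  · exact (hs.hasStrictFDerivAt' hd hω).eventually_right_inverse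

/-- A holomorphic map that vanishes on the hypersurface `{y = 0}` is divisible by `y`. -/
theorem exists_eq_smul [CompleteSpace E] [CompleteSpace F] (hy : IsEquationAt y x₀) {f : E → F}
    (hf : AnalyticAt ℂ f x₀) (h : ∀ᶠ x in 𝓝 x₀, y x = 0 → f x = 0) :
    ∃ g : E → F, AnalyticAt ℂ g x₀ ∧ ∀ᶠ x in 𝓝 x₀, f x = y x • g x := by
  obtain ⟨Ψ, Φ, L, v, hv, hΨ, hΦ, hLΨ, hl, hr⟩ := hy.exists_straightening
  have hx₀ : Φ (Ψ x₀) = x₀ := hl.self_of_nhds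
  have hL₀ : L (Ψ x₀) = 0 := by rw [hLΨ, hy.apply_eq_zero]
  obtain ⟨g, hg, hfg⟩ := exists_analyticAt_sub_comp_kerProj (f := f ∘ Φ) (x₀ := Ψ x₀)
    (by rw [← hx₀] at hf; exact hf.comp hΦ) hL₀ v
  have ht : Filter.Tendsto (kerProj L v) (𝓝 (Ψ x₀)) (𝓝 (Ψ x₀)) := by
    have := (kerProj L v).continuous.tendsto (Ψ x₀)
    rwa [kerProj_eq_self v hL₀] at this
  have ht' : Filter.Tendsto Φ (𝓝 (Ψ x₀)) (𝓝 x₀) := by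
    have := hΦ.continuousAt.tendsto
    rwa [hx₀] at this
  refine ⟨g ∘ Ψ, hg.comp hΨ, ?_⟩
  filter_upwards [hΨ.continuousAt.eventually hfg, hl,
    hΨ.continuousAt.eventually (ht.eventually (ht'.eventually h)),
    hΨ.continuousAt.eventually (ht.eventually hr)] with x h1 h2 h3 h4
  have h5 : f (Φ (kerProj L v (Ψ x))) = 0 := h3 (by rw [← hLΨ, h4, apply_kerProj hv])
  simp only [Function.comp_apply, h5, sub_zero, h2, hLΨ] at h1
  exact h1

/-- The maximum principle on the complex manifold `{y = 0}`. -/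
theorem eventually_eq_of_norm_le [CompleteSpace E] (hy : IsEquationAt y x₀) {f : E → ℂ}
    (hf : AnalyticAt ℂ f x₀) (h : ∀ᶠ x in 𝓝 x₀, y x = 0 → ‖f x‖ ≤ ‖f x₀‖) :
    ∀ᶠ x in 𝓝 x₀, y x = 0 → f x = f x₀ := by
  obtain ⟨Ψ, Φ, L, v, hv, hΨ, hΦ, hLΨ, hl, hr⟩ := hy.exists_straightening
  have hx₀ : Φ (Ψ x₀) = x₀ := hl.self_of_nhds
  have hL₀ : L (Ψ x₀) = 0 := by rw [hLΨ, hy.apply_eq_zero]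
  have hz₀ : kerProj L v (Ψ x₀) = Ψ x₀ := kerProj_eq_self v hL₀
  have ht : Filter.Tendsto (kerProj L v) (𝓝 (Ψ x₀)) (𝓝 (Ψ x₀)) := by
    have := (kerProj L v).continuous.tendsto (Ψ x₀)
    rwa [hz₀] at this
  have ht' : Filter.Tendsto Φ (𝓝 (Ψ x₀)) (𝓝 x₀) := by
    have := hΦ.continuousAt.tendsto
    rwa [hx₀] at this
  have hG : AnalyticAt ℂ (fun z => f (Φ (kerProj L v z))) (Ψ x₀) := by
    have h1 : AnalyticAt ℂ (f ∘ Φ) (kerProj L v (Ψ x₀)) := by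
      rw [hz₀]; rw [← hx₀] at hf; exact hf.comp hΦ
    exact h1.comp ((kerProj L v).analyticAt _)
  have hmax : IsLocalMax (norm ∘ fun z => f (Φ (kerProj L v z))) (Ψ x₀) := by
    filter_upwards [ht.eventually (ht'.eventually h), ht.eventually hr] with z h1 h2
    simp only [Function.comp_apply, hz₀, hx₀]
    exact h1 (by rw [← hLΨ, h2, apply_kerProj hv])
  have hc := Complex.eventually_eq_of_isLocalMax_norm
    (hG.eventually_analyticAt.mono fun z hz => hz.differentiableAt) hmax
  filter_upwards [hΨ.continuousAt.eventually hc, hl] with x h1 h2 h3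
  rw [kerProj_eq_self v (by rw [hLΨ, h3]), h2, hz₀, hx₀] at h1
  exact h1

/-- Two local equations of the same hypersurface differ by a unit. -/
theorem exists_unit [CompleteSpace E] (hy : IsEquationAt y x₀) {y' : E → ℂ}
    (hy' : IsEquationAt y' x₀) (h : ∀ᶠ x in 𝓝 x₀, y x = 0 ↔ y' x = 0) :
    ∃ u : E → ℂ, AnalyticAt ℂ u x₀ ∧ u x₀ ≠ 0 ∧ ∀ᶠ x in 𝓝 x₀, y' x = u x * y x := by
  obtain ⟨u, hu, hyu⟩ := hy.exists_eq_smul hy'.analyticAt (h.mono fun x hx => hx.1)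
  obtain ⟨w, hw, hyw⟩ := hy'.exists_eq_smul hy.analyticAt (h.mono fun x hx => hx.2)
  have h1 : ∀ᶠ x in 𝓝 x₀, w x * u x = 1 := by
    refine hy.eventually_eq (hw.mul hu) analyticAt_const ?_
    filter_upwards [hyu, hyw] with x h2 h3 h4
    rw [smul_eq_mul] at h2 h3
    rw [h2] at h3
    have : y x * (w x * u x) = y x * 1 := by rw [mul_one]; nth_rw 2 [h3]; ring
    exact mul_left_cancel₀ h4 this
  refine ⟨u, hu, fun h0 => ?_, ?_⟩
  · have := h1.self_of_nhds
    simp [h0] at this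
  · filter_upwards [hyu] with x hx
    rw [hx, smul_eq_mul, mul_comm]

end IsEquationAt

/-- `A` is holomorphic off the hypersurface `{y = 0}` and has order at least `n` along it,
near `x₀`. -/
def OrdGE (y : E → ℂ) (n : ℤ) (A : E → F) (x₀ : E) : Prop :=
  ∃ θ : E → F, AnalyticAt ℂ θ x₀ ∧ ∀ᶠ x in 𝓝 x₀, y x ≠ 0 → A x = y x ^ n • θ x

namespace OrdGE

variable {y : E → ℂ} {x₀ : E} {n m : ℤ} {A B : E → F}

theorem congr (hA : OrdGE y n A x₀) (h : ∀ᶠ x in 𝓝 x₀, y x ≠ 0 → A x = B x) : OrdGE y n B x₀ := by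
  obtain ⟨θ, hθ, hAθ⟩ := hA
  refine ⟨θ, hθ, ?_⟩
  filter_upwards [hAθ, h] with x h1 h2 h3
  rw [← h2 h3, h1 h3]

theorem add (hA : OrdGE y n A x₀) (hB : OrdGE y n B x₀) : OrdGE y n (fun x => A x + B x) x₀ := by
  obtain ⟨θ, hθ, hAθ⟩ := hA
  obtain ⟨η, hη, hBη⟩ := hB
  refine ⟨fun x => θ x + η x, hθ.add hη, ?_⟩
  filter_upwards [hAθ, hBη] with x h1 h2 h3
  rw [h1 h3, h2 h3, smul_add]

theorem neg (hA : OrdGE y n A x₀) : OrdGE y n (fun x => - A x) x₀ := by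
  obtain ⟨θ, hθ, hAθ⟩ := hA
  refine ⟨fun x => - θ x, hθ.neg, ?_⟩
  filter_upwards [hAθ] with x h1 h3
  rw [h1 h3, smul_neg]

theorem sub (hA : OrdGE y n A x₀) (hB : OrdGE y n B x₀) : OrdGE y n (fun x => A x - B x) x₀ := by
  simpa only [sub_eq_add_neg] using hA.add hB.neg

theorem mono (hA : OrdGE y n A x₀) (hmn : m ≤ n) (hy : AnalyticAt ℂ y x₀) : OrdGE y m A x₀ := by
  obtain ⟨θ, hθ, hAθ⟩ := hA
  refine ⟨fun x => y x ^ (n - m).toNat • θ x, (hy.pow _).smul hθ, ?_⟩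
  filter_upwards [hAθ] with x h1 h3
  rw [h1 h3, smul_smul, ← zpow_natCast, ← zpow_add₀ h3, Int.toNat_of_nonneg (by omega)]
  congr 2; ring

theorem of_unit {y' u : E → ℂ} (hu : AnalyticAt ℂ u x₀) (hu0 : u x₀ ≠ 0)
    (h : ∀ᶠ x in 𝓝 x₀, y' x = u x * y x) (hA : OrdGE y' n A x₀) : OrdGE y n A x₀ := by
  obtain ⟨θ, hθ, hAθ⟩ := hA
  refine ⟨fun x => u x ^ n • θ x, (hu.zpow hu0).smul hθ, ?_⟩
  filter_upwards [hAθ, h, hu.continuousAt.eventually_ne hu0] with x h1 h2 h3 h4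
  rw [h1 (by rw [h2]; exact mul_ne_zero h3 h4), h2, mul_zpow, smul_smul, mul_comm]

end OrdGE

theorem HasFDerivAt.zpow_smul {y : E → ℂ} {θ : E → F} {y' : E →L[ℂ] ℂ} {θ' : E →L[ℂ] F} {x : E}
    (hy : HasFDerivAt y y' x) (hθ : HasFDerivAt θ θ' x) (h : y x ≠ 0) (n : ℤ) :
    HasFDerivAt (fun z => y z ^ n • θ z)
      (y x ^ n • θ' + (((n : ℂ) * y x ^ (n - 1)) • y').smulRight (θ x)) x :=
  ((hasDerivAt_zpow n (y x) (Or.inl h)).comp_hasFDerivAt x hy).smul hθ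

/-- The exterior derivative of a one-form on a vector space, in the normalization
`dα(v, w) = (D_v α)(w) - (D_w α)(v)`. -/
def extDeriv (α : E → E →L[ℂ] ℂ) (x : E) : E →L[ℂ] E →L[ℂ] ℂ :=
  fderiv ℂ α x - (fderiv ℂ α x).flip

theorem extDeriv_add_fderiv {α : E → E →L[ℂ] ℂ} {f : E → ℂ} {x : E}
    (hα : DifferentiableAt ℂ α x) (hf : AnalyticAt ℂ f x) :
    extDeriv (fun z => α z + fderiv ℂ f z) x = extDeriv α x := by
  have h := (hf.contDiffAt (n := ω)).isSymmSndFDerivAt_of_omega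
  have h' : fderiv ℂ (fun z => α z + fderiv ℂ f z) x = fderiv ℂ α x + fderiv ℂ (fderiv ℂ f) x :=
    fderiv_fun_add hα hf.fderiv.differentiableAt
  ext v w
  simp [extDeriv, h', h.eq v w]

theorem _root_.AnalyticAt.clm_apply_const {G : Type*} [NormedAddCommGroup G] [NormedSpace ℂ G]
    {B : E → G →L[ℂ] F} {x : E} (hB : AnalyticAt ℂ B x) (v : G) :
    AnalyticAt ℂ (fun z => B z v) x :=
  AnalyticAt.fun_comp (g := ContinuousLinearMap.apply ℂ F v)
    (ContinuousLinearMap.analyticAt _ _) hB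

theorem _root_.AnalyticAt.clm_flip_apply_const {G : Type*} [NormedAddCommGroup G]
    [NormedSpace ℂ G] {B : E → E →L[ℂ] G →L[ℂ] F} {x : E} (hB : AnalyticAt ℂ B x) (v : G) :
    AnalyticAt ℂ (fun z => (B z).flip v) x :=
  AnalyticAt.clm_apply_const (B := fun z => (B z).flip) (AnalyticAt.fun_comp
    (g := (ContinuousLinearMap.flipₗᵢ ℂ E G F).toContinuousLinearEquiv.toContinuousLinearMap)
    (ContinuousLinearMap.analyticAt _ _) hB) v

namespace IsEquationAt

variable {y : E → ℂ} {x₀ : E}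

theorem eventually_eventuallyEq {G : Type*} (hy : IsEquationAt y x₀) {A B : E → G}
    (h : ∀ᶠ x in 𝓝 x₀, y x ≠ 0 → A x = B x) :
    ∀ᶠ x in 𝓝 x₀, y x ≠ 0 → A =ᶠ[𝓝 x] B := by
  filter_upwards [h.eventually_nhds, hy.analyticAt.eventually_continuousAt] with x h1 h2 h3
  filter_upwards [h1, h2.eventually_ne h3] with z h4 h5 using h4 h5

/-- Uniqueness of the polar part of a primitive: if `d (f / y ^ m)` has at most a simple pole,
then `f / y ^ m` is holomorphic. -/
theorem exists_eq_pow_mul (hy : IsEquationAt y x₀) (m : ℕ) : ∀ {f : E → ℂ}, AnalyticAt ℂ f x₀ →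
    OrdGE y (-1) (fderiv ℂ fun x => y x ^ (-(m : ℤ)) • f x) x₀ →
    ∃ g : E → ℂ, AnalyticAt ℂ g x₀ ∧ ∀ᶠ x in 𝓝 x₀, f x = y x ^ m * g x := by
  induction m with
  | zero => exact fun {f} hf _ => ⟨f, hf, by simp⟩
  | succ m ih =>
    intro f hf hd
    obtain ⟨v, hv⟩ := hy.exists_transverse
    obtain ⟨η, hη, hdη⟩ := hd
    -- off the hypersurface, `y df - (m + 1) f dy = y ^ (m + 1) η`; evaluating on `v` gives the
    -- quotient of `f` by `y`
    have hdy : AnalyticAt ℂ (fun x => fderiv ℂ y x v) x₀ :=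
      hy.analyticAt.fderiv.clm_apply_const v
    have hdf : AnalyticAt ℂ (fun x => fderiv ℂ f x v) x₀ := hf.fderiv.clm_apply_const v
    set f₁ : E → ℂ := fun x =>
      (fderiv ℂ f x v - y x ^ m * η x v) / (((m : ℂ) + 1) * fderiv ℂ y x v) with hf₁
    have hf₁a : AnalyticAt ℂ f₁ x₀ := by
      refine AnalyticAt.div (hdf.sub ((hy.analyticAt.pow m).mul
        (hη.clm_apply_const v))) (analyticAt_const.mul hdy) ?_
      rw [hv, mul_one]; exact Nat.cast_add_one_ne_zero m
    have hff₁ : ∀ᶠ x in 𝓝 x₀, f x = y x * f₁ x := by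
      refine hy.eventually_eq hf (hy.analyticAt.mul hf₁a) ?_
      filter_upwards [hdη, hy.analyticAt.eventually_analyticAt, hf.eventually_analyticAt,
        hy.eventually_fderiv_apply_ne_zero hv] with x h1 h2 h3 h4 h5
      have h6 := h1 h5
      rw [(HasFDerivAt.zpow_smul h2.differentiableAt.hasFDerivAt
        h3.differentiableAt.hasFDerivAt h5 _).fderiv] at h6
      have h7 := congrArg (fun l : E →L[ℂ] ℂ => l v) h6
      have e1 : y x ^ (-((m + 1 : ℕ) : ℤ)) = (y x ^ (m + 1))⁻¹ := by
        rw [zpow_neg, zpow_natCast]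
      have e2 : y x ^ (-((m + 1 : ℕ) : ℤ) - 1) = (y x ^ (m + 2))⁻¹ := by
        rw [← zpow_natCast, ← zpow_neg]; congr 1
      simp only [add_apply, smul_apply, smul_eq_mul,
        ContinuousLinearMap.smulRight_apply, e1, e2, zpow_neg_one] at h7
      push_cast at h7
      have hm : (m : ℂ) + 1 ≠ 0 := Nat.cast_add_one_ne_zero m
      simp only [hf₁]
      field_simp at h7 ⊢
      refine mul_left_cancel₀ (pow_ne_zero (m + 2) h5) ?_
      linear_combination (-1 : ℂ) * h7
    obtain ⟨g, hg, hfg⟩ := ih hf₁a (by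
      refine OrdGE.congr ⟨η, hη, hdη⟩ ?_
      have : ∀ᶠ x in 𝓝 x₀, y x ≠ 0 →
          y x ^ (-((m + 1 : ℕ) : ℤ)) • f x = y x ^ (-(m : ℤ)) • f₁ x := by
        filter_upwards [hff₁] with x h1 h2
        rw [h1, smul_eq_mul, smul_eq_mul, ← mul_assoc, ← zpow_add_one₀ h2]
        congr 2; push_cast; ring
      filter_upwards [hy.eventually_eventuallyEq this] with x h1 h2
      exact (h1 h2).fderiv_eq)
    refine ⟨g, hg, ?_⟩
    filter_upwards [hff₁, hfg] with x h1 h2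
    rw [h1, h2]; ring

/-- Existence of the polar part of a primitive: a one-form `α` with a pole of order at most
`m + 1`, and whose exterior derivative has at most a simple pole, differs from the derivative of
some `f / y ^ m` by a form with at most a simple pole. -/
theorem exists_primitive [CompleteSpace E] (hy : IsEquationAt y x₀) (m : ℕ) :
    ∀ {α : E → E →L[ℂ] ℂ},
    OrdGE y (-((m : ℤ) + 1)) α x₀ → OrdGE y (-1) (extDeriv α) x₀ →
    ∃ f : E → ℂ, AnalyticAt ℂ f x₀ ∧
      OrdGE y (-1) (fun x => α x - fderiv ℂ (fun x => y x ^ (-(m : ℤ)) • f x) x) x₀ := by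
  induction m with
  | zero =>
    intro α hα _
    exact ⟨fun _ => 0, analyticAt_const, by simpa using hα⟩
  | succ m ih =>
    intro α hα hd
    obtain ⟨v, hv⟩ := hy.exists_transverse
    obtain ⟨θ, hθ, hαθ⟩ := hα
    obtain ⟨ξ, hξ, hdξ⟩ := id hd
    have hm : (m : ℂ) + 1 ≠ 0 := Nat.cast_add_one_ne_zero m
    have hm2 : (m : ℂ) + 2 ≠ 0 := by
      have := Nat.cast_add_one_ne_zero (R := ℂ) (m + 1)
      push_cast at this
      rwa [add_assoc, one_add_one_eq_two] at this
    have hdy : AnalyticAt ℂ (fun x => fderiv ℂ y x v) x₀ :=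
      hy.analyticAt.fderiv.clm_apply_const v
    have hdy0 : fderiv ℂ y x₀ v ≠ 0 := by rw [hv]; exact one_ne_zero
    -- the polar coefficient
    set a : E → ℂ := fun x => θ x v / fderiv ℂ y x v with ha
    have haa : AnalyticAt ℂ a x₀ := (hθ.clm_apply_const v).div hdy hdy0
    -- `dα = O(1 / y)` forces `dy ∧ θ` to vanish on the hypersurface, so `θ - a dy` is divisible
    -- by `y`
    set G : E → E →L[ℂ] ℂ := fun x => (-(((m : ℂ) + 2) * fderiv ℂ y x v)⁻¹) •
      ((fderiv ℂ θ x).flip v - fderiv ℂ θ x v - y x ^ (m + 1) • (ξ x).flip v) with hG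
    have hGa : AnalyticAt ℂ G x₀ := by
      refine AnalyticAt.smul (AnalyticAt.neg (AnalyticAt.inv (analyticAt_const.mul hdy) ?_))
        (((hθ.fderiv.clm_flip_apply_const v).sub (hθ.fderiv.clm_apply_const v)).sub
          ((hy.analyticAt.pow _).smul (hξ.clm_flip_apply_const v)))
      exact mul_ne_zero hm2 hdy0
    have hθG : ∀ᶠ x in 𝓝 x₀, y x ≠ 0 → θ x = a x • fderiv ℂ y x + y x • G x := by
      filter_upwards [hdξ, hy.eventually_eventuallyEq hαθ, hy.analyticAt.eventually_analyticAt,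
        hθ.eventually_analyticAt, hy.eventually_fderiv_apply_ne_zero hv] with x h1 h2 h3 h4 h5 h6
      have h7 := h1 h6
      rw [extDeriv, (h2 h6).fderiv_eq, (HasFDerivAt.zpow_smul h3.differentiableAt.hasFDerivAt
        h4.differentiableAt.hasFDerivAt h6 _).fderiv] at h7
      ext u
      have h8 := congrArg (fun l : E →L[ℂ] E →L[ℂ] ℂ => l u v) h7
      have e1 : y x ^ (-(((m + 1 : ℕ) : ℤ) + 1)) = (y x ^ (m + 2))⁻¹ := by
        rw [← zpow_natCast, ← zpow_neg]; congr 1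
      have e2 : y x ^ (-(((m + 1 : ℕ) : ℤ) + 1) - 1) = (y x ^ (m + 3))⁻¹ := by
        rw [← zpow_natCast, ← zpow_neg]; congr 1
      simp only [add_apply, sub_apply, smul_apply, smul_eq_mul, ContinuousLinearMap.flip_apply,
        ContinuousLinearMap.smulRight_apply, e1, e2, zpow_neg_one] at h8
      push_cast at h8
      simp only [hG, ha, add_apply, sub_apply, smul_apply, smul_eq_mul,
        ContinuousLinearMap.flip_apply]
      field_simp at h8 ⊢
      refine mul_left_cancel₀ (pow_ne_zero (m + 3) h6) ?_
      linear_combination h8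
    -- subtracting the exact polar part lowers the pole order
    set s : E → ℂ := fun x => y x ^ (-((m + 1 : ℕ) : ℤ)) • (((m : ℂ) + 1)⁻¹ * a x) with hs
    have hsa : ∀ᶠ x in 𝓝 x₀, y x ≠ 0 → AnalyticAt ℂ s x := by
      filter_upwards [hy.analyticAt.eventually_analyticAt, haa.eventually_analyticAt]
        with x h1 h2 h3
      exact (h1.zpow h3).smul (analyticAt_const.mul h2)
    have hord : OrdGE y (-((m : ℤ) + 1)) (fun x => α x + fderiv ℂ s x) x₀ := by
      refine ⟨fun x => G x + ((m : ℂ) + 1)⁻¹ • fderiv ℂ a x,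
        hGa.add (AnalyticAt.fun_smul analyticAt_const haa.fderiv), ?_⟩
      filter_upwards [hθG, hαθ, hy.analyticAt.eventually_analyticAt, haa.eventually_analyticAt]
        with x h1 h2 h3 h4 h5
      rw [h2 h5, h1 h5, hs, (HasFDerivAt.zpow_smul h3.differentiableAt.hasFDerivAt
        (h4.differentiableAt.hasFDerivAt.const_mul _) h5 _).fderiv]
      ext u
      have e1 : y x ^ (-(((m + 1 : ℕ) : ℤ) + 1)) = (y x ^ (m + 2))⁻¹ := by
        rw [← zpow_natCast, ← zpow_neg]; congr 1
      have e2 : y x ^ (-((m + 1 : ℕ) : ℤ) - 1) = (y x ^ (m + 2))⁻¹ := by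
        rw [← zpow_natCast, ← zpow_neg]; congr 1
      have e3 : y x ^ (-((m + 1 : ℕ) : ℤ)) = (y x ^ (m + 1))⁻¹ := by
        rw [← zpow_natCast, ← zpow_neg]
      have e4 : y x ^ (-((m : ℤ) + 1)) = (y x ^ (m + 1))⁻¹ := by
        rw [← zpow_natCast, ← zpow_neg]; congr 1
      simp only [add_apply, smul_apply, smul_eq_mul,
        ContinuousLinearMap.smulRight_apply, e1, e2, e3, e4]
      push_cast
      field_simp
      ring
    have hcl : OrdGE y (-1) (extDeriv fun x => α x + fderiv ℂ s x) x₀ := by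
      refine hd.congr ?_
      filter_upwards [hsa, hy.eventually_eventuallyEq hαθ, hy.analyticAt.eventually_analyticAt,
        hθ.eventually_analyticAt] with x h1 h2 h3 h4 h5
      refine (extDeriv_add_fderiv ?_ (h1 h5)).symm
      exact (h2 h5).differentiableAt_iff.2 (HasFDerivAt.zpow_smul h3.differentiableAt.hasFDerivAt
        h4.differentiableAt.hasFDerivAt h5 _).differentiableAt
    obtain ⟨f, hf, hfo⟩ := ih hord hcl
    refine ⟨fun x => y x * f x - ((m : ℂ) + 1)⁻¹ * a x,
      (hy.analyticAt.mul hf).sub (analyticAt_const.mul haa), hfo.congr ?_⟩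
    have hsub : ∀ᶠ x in 𝓝 x₀, y x ≠ 0 →
        y x ^ (-((m + 1 : ℕ) : ℤ)) • (y x * f x - ((m : ℂ) + 1)⁻¹ * a x) =
        y x ^ (-(m : ℤ)) • f x - s x := by
      refine .of_forall fun x hx => ?_
      simp only [hs, smul_eq_mul, mul_sub, ← mul_assoc, ← zpow_add_one₀ hx]
      congr 3; push_cast; ring
    filter_upwards [hy.eventually_eventuallyEq hsub, hsa, hy.analyticAt.eventually_analyticAt,
      hf.eventually_analyticAt] with x h1 h2 h3 h4 h5
    have h6 : DifferentiableAt ℂ (fun x => y x ^ (-(m : ℤ)) • f x) x :=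
      ((h3.zpow h5).smul h4).differentiableAt
    rw [(h1 h5).fderiv_eq, fderiv_fun_sub h6 (h2 h5).differentiableAt]
    abel

end IsEquationAt

end LocalEquation

/-! ### Charts and orders along the hypersurface -/

section Charts

variable {E : Type*} [NormedAddCommGroup E] [NormedSpace ℂ E]
  {U : Type*} [TopologicalSpace U] [ChartedSpace E U]
  {F : Type*} [NormedAddCommGroup F] [NormedSpace ℂ F]

theorem eventually_chart_iff {E : Type*} [TopologicalSpace E] {U : Type*} [TopologicalSpace U]
    [ChartedSpace E U] (r : U) (P : U → Prop) :
    (∀ᶠ x in 𝓝 (chartAt E r r), P ((chartAt E r).symm x)) ↔ ∀ᶠ q in 𝓝 r, P q :=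
  (chartAt E r).eventually_nhds' P (mem_chart_source E r)

theorem holAt_iff [IsManifold 𝓘(ℂ, E) ω U] (f : U → ℂ) (r : U) :
    HolAt E f r ↔ AnalyticAt ℂ (fun x => f ((chartAt E r).symm x)) (chartAt E r r) := by
  rw [HolAt, contMDiffAt_iff_source, extChartAt_coe]
  simp only [modelWithCornersSelf_coe, Set.range_id, contMDiffWithinAt_univ,
    contMDiffAt_iff_contDiffAt]
  exact ⟨ContDiffAt.analyticAt, AnalyticAt.contDiffAt⟩

theorem HolAt.comp_chart [IsManifold 𝓘(ℂ, E) ω U]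
    {f : E → ℂ} {r : U} (hf : AnalyticAt ℂ f (chartAt E r r)) :
    HolAt E (fun q => f (chartAt E r q)) r := by
  have h1 : ContMDiffAt 𝓘(ℂ, E) 𝓘(ℂ, ℂ) ω f (chartAt E r r) := hf.contDiffAt.contMDiffAt
  exact h1.comp r (contMDiffAt_of_mem_maximalAtlas (IsManifold.chart_mem_maximalAtlas r)
    (mem_chart_source E r))

theorem HolAt.eventually [IsManifold 𝓘(ℂ, E) ω U]
    {f : U → ℂ} {r : U} (hf : HolAt E f r) :
    ∀ᶠ q in 𝓝 r, HolAt E f q :=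
  (contMDiffAt_iff_contMDiffAt_nhds (by simp)).1 hf

theorem HolAt.continuousAt {f : U → ℂ} {r : U} (hf : HolAt E f r) : ContinuousAt f r :=
  ContMDiffAt.continuousAt hf

theorem IsLocalEquation.isEquationAt [IsManifold 𝓘(ℂ, E) ω U]
    {Y : Set U} {y : U → ℂ} {r : U} (hy : IsLocalEquation E Y y r)
    (hr : r ∈ Y) : IsEquationAt (fun x => y ((chartAt E r).symm x)) (chartAt E r r) where
  analyticAt := (holAt_iff y r).1 hy.hol
  apply_eq_zero := by
    simpa [(chartAt E r).left_inv (mem_chart_source E r)] using hy.zeros.self_of_nhds.1 hr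
  fderiv_ne_zero := by
    intro h
    apply hy.submersion
    have hd : MDifferentiableAt 𝓘(ℂ, E) 𝓘(ℂ, ℂ) y r :=
      ContMDiffAt.mdifferentiableAt hy.hol (by simp)
    refine hd.mfderiv.trans ?_
    change fderivWithin ℂ (fun x => y ((chartAt E r).symm x)) (Set.range id) (chartAt E r r) = 0
    rw [Set.range_id, fderivWithin_univ, h]

theorem IsLocalEquation.exists_unit [IsManifold 𝓘(ℂ, E) ω U]
    [CompleteSpace E] {Y : Set U} {y y' : U → ℂ} {r : U}
    (hy : IsLocalEquation E Y y r) (hy' : IsLocalEquation E Y y' r) (hr : r ∈ Y) :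
    ∃ u : E → ℂ, AnalyticAt ℂ u (chartAt E r r) ∧ u (chartAt E r r) ≠ 0 ∧
      ∀ᶠ x in 𝓝 (chartAt E r r),
        y' ((chartAt E r).symm x) = u x * y ((chartAt E r).symm x) := by
  refine (hy.isEquationAt hr).exists_unit (hy'.isEquationAt hr) ?_
  refine (eventually_chart_iff r fun q => y q = 0 ↔ y' q = 0).2 ?_
  filter_upwards [hy.zeros, hy'.zeros] with q h1 h2
  rw [← h1, h2]

/-- The order along `Y` can be computed with any local equation. -/
theorem OrderGE.ordGE [IsManifold 𝓘(ℂ, E) ω U]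
    [CompleteSpace E] {Y : Set U} {n : ℤ} {r : U} {A : E → F}
    (hA : OrderGE Y n r A) {y : U → ℂ} (hy : IsLocalEquation E Y y r) (hr : r ∈ Y) :
    OrdGE (fun x => y ((chartAt E r).symm x)) n A (chartAt E r r) := by
  obtain ⟨y', θ, hy', hθ, h⟩ := hA
  obtain ⟨u, hu, hu0, hyu⟩ := hy.exists_unit hy' hr
  refine OrdGE.of_unit hu hu0 hyu ⟨θ, hθ, ?_⟩
  filter_upwards [h, (eventually_chart_iff r fun q => q ∈ Y ↔ y' q = 0).2 hy'.zeros]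
    with x h1 h2 h3
  exact h1 fun h4 => h3 (h2.1 h4)

theorem OrdGE.orderGE {Y : Set U} {n : ℤ} {r : U} {A : E → F} {y : U → ℂ}
    (hA : OrdGE (fun x => y ((chartAt E r).symm x)) n A (chartAt E r r))
    (hy : IsLocalEquation E Y y r) : OrderGE Y n r A := by
  obtain ⟨θ, hθ, h⟩ := hA
  refine ⟨y, θ, hy, hθ, ?_⟩
  filter_upwards [h, (eventually_chart_iff r fun q => q ∈ Y ↔ y q = 0).2 hy.zeros]
    with x h1 h2 h3
  exact h1 fun h4 => h3 (h2.2 h4)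

theorem OrdGE.of_isLocalEquation [IsManifold 𝓘(ℂ, E) ω U]
    [CompleteSpace E] {Y : Set U} {n : ℤ} {r : U} {A : E → F}
    {y y' : U → ℂ} (hA : OrdGE (fun x => y' ((chartAt E r).symm x)) n A (chartAt E r r))
    (hy' : IsLocalEquation E Y y' r) (hy : IsLocalEquation E Y y r) (hr : r ∈ Y) :
    OrdGE (fun x => y ((chartAt E r).symm x)) n A (chartAt E r r) :=
  (hA.orderGE hy').ordGE hy hr

theorem memIdealPow_of_chart [IsManifold 𝓘(ℂ, E) ω U]
    {Y : Set U} {m : ℕ} {f y : U → ℂ} {r : U}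
    (hy : IsLocalEquation E Y y r) {g : E → ℂ} (hg : AnalyticAt ℂ g (chartAt E r r))
    (h : ∀ᶠ x in 𝓝 (chartAt E r r),
      f ((chartAt E r).symm x) = y ((chartAt E r).symm x) ^ m * g x) :
    MemIdealPow E Y m f r := by
  refine ⟨y, fun q => g (chartAt E r q), hy, HolAt.comp_chart hg, ?_⟩
  refine (eventually_chart_iff (E := E) r fun q => f q = y q ^ m * g (chartAt E r q)).1 ?_
  filter_upwards [h, (chartAt E r).open_target.mem_nhds (mem_chart_target E r)] with x h1 h2
  rw [h1, (chartAt E r).right_inv h2]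

/-- The change of coordinates from the chart at `r` to the chart at `p`. Off the overlap of the two
charts it takes junk values. -/
def chartChange (E : Type*) [TopologicalSpace E] {U : Type*} [TopologicalSpace U]
    [ChartedSpace E U] (p r : U) (x : E) : E :=
  chartAt E p ((chartAt E r).symm x)

theorem eventually_mem_chart (E : Type*) [TopologicalSpace E] {U : Type*} [TopologicalSpace U]
    [ChartedSpace E U] {p r : U} (hr : r ∈ (chartAt E p).source) :
    ∀ᶠ x in 𝓝 (chartAt E r r),
      x ∈ (chartAt E r).target ∧ (chartAt E r).symm x ∈ (chartAt E p).source := by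
  refine Filter.Eventually.and ((chartAt E r).open_target.mem_nhds (mem_chart_target E r)) ?_
  exact (eventually_chart_iff r fun q => q ∈ (chartAt E p).source).2
    ((chartAt E p).open_source.mem_nhds hr)

theorem chartChange_analyticAt [IsManifold 𝓘(ℂ, E) ω U]
    {p r : U} {x : E} (hx : x ∈ (chartAt E r).target)
    (hx' : (chartAt E r).symm x ∈ (chartAt E p).source) :
    AnalyticAt ℂ (chartChange E p r) x := by
  refine ContDiffAt.analyticAt (contMDiffAt_iff_contDiffAt.1 ?_)
  exact (contMDiffAt_of_mem_maximalAtlas (IsManifold.chart_mem_maximalAtlas p) hx').comp x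
    (contMDiffAt_symm_of_mem_maximalAtlas (IsManifold.chart_mem_maximalAtlas r) hx)

theorem comp_chart_symm_eventuallyEq {E : Type*} [TopologicalSpace E] {U : Type*}
    [TopologicalSpace U] [ChartedSpace E U] {G : Type*} (s : U → G) {p r : U} {x : E}
    (hx : x ∈ (chartAt E r).target) (hx' : (chartAt E r).symm x ∈ (chartAt E p).source) :
    (fun z => s ((chartAt E r).symm z)) =ᶠ[𝓝 x]
      fun z => s ((chartAt E p).symm (chartChange E p r z)) := by
  have h1 : ∀ᶠ z in 𝓝 x, (chartAt E r).symm z ∈ (chartAt E p).source :=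
    ((chartAt E r).continuousAt_symm hx).eventually ((chartAt E p).open_source.mem_nhds hx')
  filter_upwards [h1] with z hz
  rw [chartChange, (chartAt E p).left_inv hz]

/-- Transformation of the coordinate expression of a one-form under a change of charts. -/
theorem chartForm_eq_comp [IsManifold 𝓘(ℂ, E) ω U]
    (α : OneForm E U) {p r : U} {x : E} (hx : x ∈ (chartAt E r).target)
    (hx' : (chartAt E r).symm x ∈ (chartAt E p).source) :
    chartForm α r x =
      (chartForm α p (chartChange E p r x)).comp (fderiv ℂ (chartChange E p r) x) := by
  have hτx : chartChange E p r x ∈ (chartAt E p).target := (chartAt E p).map_source hx'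
  have hq : (chartAt E p).symm (chartChange E p r x) = (chartAt E r).symm x :=
    (chartAt E p).left_inv hx'
  have hτ : MDifferentiableAt 𝓘(ℂ, E) 𝓘(ℂ, E) (chartChange E p r) x :=
    (chartChange_analyticAt hx hx').differentiableAt.mdifferentiableAt
  have hs : MDifferentiableAt 𝓘(ℂ, E) 𝓘(ℂ, E) (chartAt E p).symm (chartChange E p r x) :=
    (contMDiffAt_symm_of_mem_maximalAtlas (n := ω) (I := 𝓘(ℂ, E))
      (IsManifold.chart_mem_maximalAtlas p) hτx).mdifferentiableAt (by simp)
  have h1 : (mfderiv 𝓘(ℂ, E) 𝓘(ℂ, E) (chartAt E r).symm x : E →L[ℂ] E) =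
      (mfderiv 𝓘(ℂ, E) 𝓘(ℂ, E) (chartAt E p).symm (chartChange E p r x) : E →L[ℂ] E).comp
        (fderiv ℂ (chartChange E p r) x) := by
    have h2 := (comp_chart_symm_eventuallyEq id hx hx').mfderiv_eq (I := 𝓘(ℂ, E)) (I' := 𝓘(ℂ, E))
    have h3 := mfderiv_comp x hs hτ
    rw [mfderiv_eq_fderiv] at h3
    exact h2.trans h3
  ext u
  have h4 := congrArg (fun l : E →L[ℂ] E => l u) h1
  have h5 : ∀ q q' : U, q = q' → ∀ w : E, (α q : E →L[ℂ] ℂ) w = (α q' : E →L[ℂ] ℂ) w := by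
    rintro q _ rfl w; rfl
  calc (α ((chartAt E r).symm x) : E →L[ℂ] ℂ)
        ((mfderiv 𝓘(ℂ, E) 𝓘(ℂ, E) (chartAt E r).symm x : E →L[ℂ] E) u)
      = (α ((chartAt E r).symm x) : E →L[ℂ] ℂ)
        ((mfderiv 𝓘(ℂ, E) 𝓘(ℂ, E) (chartAt E p).symm (chartChange E p r x) : E →L[ℂ] E)
          (fderiv ℂ (chartChange E p r) x u)) := congrArg _ h4
    _ = _ := h5 _ _ hq.symm _

/-- If `s` is a primitive of `α` near `p` up to terms of order at least `n`, then the same holds in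
the charts at the nearby points. -/
theorem eventually_ordGE_sub_fderiv [CompleteSpace E] [IsManifold 𝓘(ℂ, E) ω U]
    (α : OneForm E U) (y s : U → ℂ) (n : ℤ) (p : U)
    (hs : ∀ᶠ x in 𝓝 (chartAt E p p), y ((chartAt E p).symm x) ≠ 0 →
      DifferentiableAt ℂ (fun z => s ((chartAt E p).symm z)) x)
    (h : OrdGE (fun x => y ((chartAt E p).symm x)) n
      (fun x => chartForm α p x - fderiv ℂ (fun z => s ((chartAt E p).symm z)) x)
      (chartAt E p p)) :
    ∀ᶠ r in 𝓝 p, OrdGE (fun x => y ((chartAt E r).symm x)) n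
      (fun x => chartForm α r x - fderiv ℂ (fun z => s ((chartAt E r).symm z)) x)
      (chartAt E r r) := by
  obtain ⟨θ, hθ, hαθ⟩ := h
  have hc := (chartAt E p).continuousAt (mem_chart_source E p)
  filter_upwards [(chartAt E p).open_source.mem_nhds (mem_chart_source E p),
    hc.eventually hs.eventually_nhds, hc.eventually hαθ.eventually_nhds,
    hc.eventually hθ.eventually_analyticAt] with r hr h1 h2 h3
  have hrr := (eventually_mem_chart E hr).self_of_nhds
  have hτr : chartChange E p r (chartAt E r r) = chartAt E p r := by
    rw [chartChange, (chartAt E r).left_inv (mem_chart_source E r)]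
  have hτ := chartChange_analyticAt hrr.1 hrr.2
  have ht : Filter.Tendsto (chartChange E p r) (𝓝 (chartAt E r r)) (𝓝 (chartAt E p r)) := by
    have := hτ.continuousAt.tendsto
    rwa [hτr] at this
  refine ⟨fun x => (θ (chartChange E p r x)).comp (fderiv ℂ (chartChange E p r) x), ?_, ?_⟩
  · have h4 : AnalyticAt ℂ (fun x => θ (chartChange E p r x)) (chartAt E r r) := by
      refine AnalyticAt.fun_comp ?_ hτ
      rwa [hτr]
    exact ((ContinuousLinearMap.compL ℂ E E ℂ).analyticAt_bilinear _).comp₂ h4 hτ.fderiv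
  · filter_upwards [eventually_mem_chart E hr, ht.eventually h1, ht.eventually h2]
      with x hx h5 h6 h7
    have hq : (chartAt E p).symm (chartChange E p r x) = (chartAt E r).symm x :=
      (chartAt E p).left_inv hx.2
    rw [hq] at h5 h6
    rw [chartForm_eq_comp α hx.1 hx.2, (comp_chart_symm_eventuallyEq s hx.1 hx.2).fderiv_eq]
    have h8 := fderiv_comp x (h5 h7) (chartChange_analyticAt hx.1 hx.2).differentiableAt
    rw [Function.comp_def] at h8
    rw [h8, ← ContinuousLinearMap.sub_comp, h6 h7, ContinuousLinearMap.smul_comp]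

end Charts

/-! ### Powers of the ideal sheaf -/

section IdealPowers

variable {E : Type*} [NormedAddCommGroup E] [NormedSpace ℂ E]
  {U : Type*} [TopologicalSpace U] [ChartedSpace E U]
  {Y : Set U} {m n : ℕ} {f g : U → ℂ} {r : U}

namespace MemIdealPow

theorem congr (hf : MemIdealPow E Y m f r) (h : f =ᶠ[𝓝 r] g) : MemIdealPow E Y m g r := by
  obtain ⟨y, a, hy, ha, hfa⟩ := hf
  exact ⟨y, a, hy, ha, h.symm.trans hfa⟩

theorem mul_holAt (hf : MemIdealPow E Y m f r) (hg : HolAt E g r) :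
    MemIdealPow E Y m (fun x => g x * f x) r := by
  obtain ⟨y, a, hy, ha, hfa⟩ := hf
  refine ⟨y, fun x => g x * a x, hy, ContMDiffAt.mul hg ha, ?_⟩
  filter_upwards [hfa] with x hx
  rw [hx]; ring

theorem const_mul (hf : MemIdealPow E Y m f r) (c : ℂ) :
    MemIdealPow E Y m (fun x => c * f x) r :=
  hf.mul_holAt contMDiffAt_const

theorem mono (hf : MemIdealPow E Y m f r) (hmn : n ≤ m) : MemIdealPow E Y n f r := by
  obtain ⟨y, a, hy, ha, hfa⟩ := hf
  refine ⟨y, fun x => y x ^ (m - n) * a x, hy, ContMDiffAt.mul (ContMDiffAt.pow hy.hol _) ha, ?_⟩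
  filter_upwards [hfa] with x hx
  rw [hx, ← mul_assoc, ← pow_add, Nat.add_sub_cancel' hmn]

theorem apply_eq_zero (hf : MemIdealPow E Y m f r) (hm : m ≠ 0) (hr : r ∈ Y) : f r = 0 := by
  obtain ⟨y, a, hy, ha, hfa⟩ := hf
  have h : f r = y r ^ m * a r := hfa.self_of_nhds
  rw [h, hy.zeros.self_of_nhds.1 hr, zero_pow hm, zero_mul]

/-- Uniqueness of `k`-th roots modulo a power of the ideal, given their value at `r`. -/
theorem sub_of_pow_sub_pow {a b : U → ℂ} {k : ℕ} (hk : k ≠ 0) (ha : HolAt E a r)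
    (hb : HolAt E b r) (hab : a r = b r) (hb0 : b r ≠ 0)
    (h : MemIdealPow E Y m (fun x => a x ^ k - b x ^ k) r) :
    MemIdealPow E Y m (fun x => a x - b x) r := by
  set S : U → ℂ := fun x => ∑ i ∈ Finset.range k, a x ^ i * b x ^ (k - 1 - i) with hS
  have hSh : HolAt E S r := by
    simp only [HolAt, hS]
    exact contMDiffAt_finsetSum fun i _ =>
      ContMDiffAt.mul (ContMDiffAt.pow ha _) (ContMDiffAt.pow hb _)
  have hS0 : S r ≠ 0 := by
    have : S r = k * b r ^ (k - 1) := by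
      simp only [hS, hab]
      rw [Finset.sum_congr rfl (g := fun _ => b r ^ (k - 1)) fun i hi => ?_]
      · simp
      · rw [← pow_add]; congr 1; have := Finset.mem_range.1 hi; omega
    rw [this]
    exact mul_ne_zero (Nat.cast_ne_zero.2 hk) (pow_ne_zero _ hb0)
  refine (h.mul_holAt (ContMDiffAt.inv₀ hSh hS0)).congr ?_
  filter_upwards [hSh.continuousAt.eventually_ne hS0] with x hx
  rw [← geom_sum₂_mul]
  exact inv_mul_cancel_left₀ hx _

end MemIdealPow

end IdealPowers

/-! ### Sections of flat unitary bundles -/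

section FlatSections

variable {E : Type*} [NormedAddCommGroup E] [NormedSpace ℂ E] [CompleteSpace E]
  {U : Type*} [TopologicalSpace U] [ChartedSpace E U] [IsManifold 𝓘(ℂ, E) ω U]
  {Y : Set U}

/-- The maximum principle on a smooth hypersurface. -/
theorem IsLocalEquation.eventually_eq_of_norm_le {y φ : U → ℂ} {r : U}
    (hy : IsLocalEquation E Y y r) (hr : r ∈ Y) (hφ : HolAt E φ r)
    (h : ∀ᶠ q in 𝓝 r, q ∈ Y → ‖φ q‖ ≤ ‖φ r‖) : ∀ᶠ q in 𝓝 r, q ∈ Y → φ q = φ r := by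
  have h1 := (hy.isEquationAt hr).eventually_eq_of_norm_le ((holAt_iff φ r).1 hφ) (by
    rw [(chartAt E r).left_inv (mem_chart_source E r)]
    refine (eventually_chart_iff r fun q => y q = 0 → ‖φ q‖ ≤ ‖φ r‖).2 ?_
    filter_upwards [h, hy.zeros] with q h1 h2 h3 using h1 (h2.2 h3))
  rw [(chartAt E r).left_inv (mem_chart_source E r)] at h1
  filter_upwards [(eventually_chart_iff r fun q => y q = 0 → φ q = φ r).1 h1, hy.zeros]
    with q h2 h3 h4 using h2 (h3.1 h4)

/-- A holomorphic section of a flat unitary line bundle on a compact connected manifold has constant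
norm, and is locally constant in the flat frames. The section is given by its expressions `φ p` in
the frames on the open sets `W p`; that the bundle is flat and unitary only enters through the fact
that the norm of the section is well defined. -/
theorem norm_eq_const_of_flat_section (hY : IsSmoothHypersurface E Y) (hYc : IsCompact Y)
    (hYi : IsConnected Y) (W : Y → Set U) (hW : ∀ p, IsOpen (W p)) (hpW : ∀ p : Y, (p : U) ∈ W p)
    (φ : Y → U → ℂ) (hφ : ∀ p, ∀ r ∈ Y ∩ W p, HolAt E (φ p) r)
    (hn : ∀ p q, ∀ r ∈ Y ∩ W p ∩ W q, ‖φ p r‖ = ‖φ q r‖) :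
    ∃ C : ℝ, (∀ p, ∀ r ∈ Y ∩ W p, ‖φ p r‖ = C) ∧
      ∀ p, ∀ r ∈ Y ∩ W p, ∀ᶠ q in 𝓝 r, q ∈ Y → φ p q = φ p r := by
  have : CompactSpace Y := isCompact_iff_compactSpace.1 hYc
  have : ConnectedSpace Y := isConnected_iff_connectedSpace.1 hYi
  set Φ : Y → ℝ := fun r => ‖φ r r‖ with hΦ
  have hΦe : ∀ p, ∀ r : Y, (r : U) ∈ W p → ‖φ p r‖ = Φ r := fun p r hr =>
    hn p r r ⟨⟨r.2, hr⟩, hpW r⟩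
  have hΦc : Continuous Φ := by
    refine continuous_iff_continuousAt.2 fun r => ?_
    have h1 : ContinuousAt (fun q : Y => ‖φ r q‖) r :=
      ((hφ r r ⟨r.2, hpW r⟩).continuousAt.comp continuousAt_subtype_val).norm
    refine h1.congr ?_
    filter_upwards [continuousAt_subtype_val.eventually ((hW r).mem_nhds (hpW r))] with q hq
    exact hΦe r q hq
  obtain ⟨r₀, -, hr₀⟩ := isCompact_univ.exists_isMaxOn Set.univ_nonempty hΦc.continuousOn
  have hmax : ∀ r, Φ r ≤ Φ r₀ := fun r => hr₀ (Set.mem_univ r)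
  have hloc : ∀ p, ∀ r : Y, (r : U) ∈ W p → Φ r = Φ r₀ →
      ∀ᶠ q in 𝓝 (r : U), q ∈ Y → φ p q = φ p r := by
    intro p r hr hrm
    obtain ⟨y, hy⟩ := hY.exists_equation r r.2
    refine hy.eventually_eq_of_norm_le r.2 (hφ p r ⟨r.2, hr⟩) ?_
    filter_upwards [(hW p).mem_nhds hr] with q hq hqY
    rw [hΦe p ⟨q, hqY⟩ hq, hΦe p r hr, hrm]
    exact hmax _
  have hcl : IsClopen {r | Φ r = Φ r₀} := by
    refine ⟨isClosed_eq hΦc continuous_const, isOpen_iff_mem_nhds.2 fun r hr => ?_⟩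
    filter_upwards [continuousAt_subtype_val.eventually (hloc r r (hpW r) hr),
      continuousAt_subtype_val.eventually ((hW r).mem_nhds (hpW r))] with q h1 h2
    have h3 : Φ q = Φ r := by rw [← hΦe r q h2, h1 q.2]
    exact h3.trans hr
  have huniv : ∀ r, Φ r = Φ r₀ := Set.eq_univ_iff_forall.1 (hcl.eq_univ ⟨r₀, rfl⟩)
  exact ⟨Φ r₀, fun p r hr => (hΦe p ⟨r, hr.1⟩ hr.2).trans (huniv _),
    fun p r hr => hloc p ⟨r, hr.1⟩ hr.2 (huniv _)⟩

end FlatSections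

/-! ### The leading coefficient of a closed formal form -/

section PolarPart

variable {E : Type*} [NormedAddCommGroup E] [NormedSpace ℂ E] [CompleteSpace E]
  {U : Type*} [TopologicalSpace U] [ChartedSpace E U] [IsManifold 𝓘(ℂ, E) ω U]
  {Y : Set U} {k : ℕ}

/-- In the chart at `r`, the one-form `β` is `d (f / y ^ k)` up to a form with at most a simple
pole. -/
def IsPrimitiveAt (k : ℕ) (β : OneForm E U) (y f : U → ℂ) (r : U) : Prop :=
  OrdGE (fun x => y ((chartAt E r).symm x)) (-1)
    (fun x => chartForm β r x - fderiv ℂ (fun z =>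
      y ((chartAt E r).symm z) ^ (-(k : ℤ)) • f ((chartAt E r).symm z)) x) (chartAt E r r)

theorem FormalForm.exists_isPrimitiveAt (α : FormalForm E Y (k + 1)) (hα : α.IsClosed) (p : Y)
    {y : U → ℂ} (hy : IsLocalEquation E Y y p) :
    ∃ f : U → ℂ, HolAt E f p ∧ ∀ᶠ r in 𝓝 (p : U), IsPrimitiveAt k (α.form k p) y f r := by
  have hye := hy.isEquationAt p.2
  have hpole : OrdGE (fun x => y ((chartAt E (p : U)).symm x)) (-((k : ℤ) + 1))
      (chartForm (α.form k p) p) (chartAt E (p : U) p) := by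
    have := (α.pole_le k p p ⟨p.2, α.mem_nhd k p⟩).ordGE hy p.2
    exact_mod_cast this
  have hcl : OrdGE (fun x => y ((chartAt E (p : U)).symm x)) (-1)
      (extDeriv (chartForm (α.form k p) p)) (chartAt E (p : U) p) := by
    have h := (hα k p p ⟨p.2, α.mem_nhd k p⟩).ordGE hy p.2
    have e : ((k : ℤ) + 1 - (((k + 1 : ℕ) : ℤ) + 1)) = -1 := by push_cast; ring
    rw [e] at h
    exact h
  obtain ⟨f, hf, hfo⟩ := hye.exists_primitive k hpole hcl
  have hinv : ∀ᶠ x in 𝓝 (chartAt E (p : U) p),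
      f (chartAt E (p : U) ((chartAt E (p : U)).symm x)) = f x := by
    filter_upwards [(chartAt E (p : U)).open_target.mem_nhds (mem_chart_target E (p : U))] with x hx
    rw [(chartAt E (p : U)).right_inv hx]
  have hinv' : ∀ᶠ x in 𝓝 (chartAt E (p : U) p), (fun z => y ((chartAt E (p : U)).symm z) ^
      (-(k : ℤ)) • f (chartAt E (p : U) ((chartAt E (p : U)).symm z))) =ᶠ[𝓝 x]
      fun z => y ((chartAt E (p : U)).symm z) ^ (-(k : ℤ)) • f z := by
    filter_upwards [hinv.eventually_nhds] with x hx
    filter_upwards [hx] with z hz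
    rw [hz]
  refine ⟨fun q => f (chartAt E (p : U) q), HolAt.comp_chart hf, ?_⟩
  refine eventually_ordGE_sub_fderiv (α.form k p) y
    (fun q => y q ^ (-(k : ℤ)) • f (chartAt E (p : U) q)) (-1) p ?_ ?_
  · filter_upwards [hinv', hye.analyticAt.eventually_analyticAt, hf.eventually_analyticAt]
      with x h1 h2 h3 h4
    exact h1.differentiableAt_iff.2 ((h2.zpow h4).smul h3).differentiableAt
  · refine hfo.congr ?_
    filter_upwards [hinv'] with x h1 _
    rw [h1.fderiv_eq]

/-- The coefficients `f` of the polar parts `f / y ^ k` of the local primitives glue, modulo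
`I ^ k`, to a section of the `k`-th power of the divisor bundle. -/
theorem IsPrimitiveAt.memIdealPow {β β' : OneForm E U} {y y' f f' g : U → ℂ} {r : U} (hr : r ∈ Y)
    (hβ : IsPrimitiveAt k β y f r) (hβ' : IsPrimitiveAt k β' y' f' r)
    (hββ' : OrderGE Y 0 r fun x => chartForm β r x - chartForm β' r x)
    (hy : IsLocalEquation E Y y r) (hy' : IsLocalEquation E Y y' r)
    (hf : HolAt E f r) (hf' : HolAt E f' r) (hg : HolAt E g r)
    (hyg : ∀ᶠ x in 𝓝 r, y x = g x * y' x) :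
    MemIdealPow E Y k (fun x => f x - g x ^ k * f' x) r := by
  set e := (chartAt E r).symm with he
  have hye := hy.isEquationAt hr
  have hye' := hy'.isEquationAt hr
  have hfa := (holAt_iff f r).1 hf
  have hfa' := (holAt_iff f' r).1 hf'
  have hga := (holAt_iff g r).1 hg
  have hygE := (eventually_chart_iff (E := E) r fun x => y x = g x * y' x).2 hyg
  have hFa : AnalyticAt ℂ (fun x => f (e x) - g (e x) ^ k * f' (e x)) (chartAt E r r) :=
    hfa.sub ((hga.pow k).mul hfa')
  have hFe : ∀ᶠ x in 𝓝 (chartAt E r r), y (e x) ≠ 0 →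
      y (e x) ^ (-(k : ℤ)) • (f (e x) - g (e x) ^ k * f' (e x)) =
        y (e x) ^ (-(k : ℤ)) • f (e x) - y' (e x) ^ (-(k : ℤ)) • f' (e x) := by
    filter_upwards [hygE] with x h1 h2
    change y (e x) = g (e x) * y' (e x) at h1
    have h3 : g (e x) ≠ 0 := fun h => h2 (by rw [h1, h, zero_mul])
    have h4 : y' (e x) ≠ 0 := fun h => h2 (by rw [h1, h, mul_zero])
    rw [smul_eq_mul, smul_eq_mul, smul_eq_mul, mul_sub, h1]
    simp only [zpow_neg, zpow_natCast]
    field_simp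
    ring
  have hd : OrdGE (fun x => y (e x)) (-1) (fderiv ℂ fun x =>
      y (e x) ^ (-(k : ℤ)) • (f (e x) - g (e x) ^ k * f' (e x))) (chartAt E r r) := by
    have h1 := ((hββ'.ordGE hy hr).mono (m := -1) (by norm_num) hye.analyticAt).sub
      (OrdGE.sub hβ (OrdGE.of_isLocalEquation hβ' hy' hy hr))
    refine h1.congr ?_
    filter_upwards [hye.eventually_eventuallyEq hFe, hye.analyticAt.eventually_analyticAt,
      hye'.analyticAt.eventually_analyticAt, hfa.eventually_analyticAt,
      hfa'.eventually_analyticAt, hygE] with x h2 h3 h4 h5 h6 h7 h8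
    have h9 : y' (e x) ≠ 0 := fun h => h8 (by rw [h7, h, mul_zero])
    have d1 : DifferentiableAt ℂ (fun x => y (e x) ^ (-(k : ℤ)) • f (e x)) x :=
      ((h3.zpow h8).smul h5).differentiableAt
    have d2 : DifferentiableAt ℂ (fun x => y' (e x) ^ (-(k : ℤ)) • f' (e x)) x :=
      ((h4.zpow h9).smul h6).differentiableAt
    rw [(h2 h8).fderiv_eq, fderiv_fun_sub d1 d2]
    abel
  obtain ⟨a, ha, hFa'⟩ := hye.exists_eq_pow_mul k hFa hd
  exact memIdealPow_of_chart hy ha hFa'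

/-- If the coefficient of the polar part vanishes on `Y`, the pole order drops. -/
theorem IsPrimitiveAt.orderGE {β : OneForm E U} {y f : U → ℂ} {r : U} (hr : r ∈ Y) (hk : 1 ≤ k)
    (hβ : IsPrimitiveAt k β y f r) (hy : IsLocalEquation E Y y r) (hf : HolAt E f r)
    (h0 : ∀ᶠ q in 𝓝 r, q ∈ Y → f q = 0) : OrderGE Y (-(k : ℤ)) r (chartForm β r) := by
  have hye := hy.isEquationAt hr
  obtain ⟨a, ha, hfa⟩ := hye.exists_eq_smul ((holAt_iff f r).1 hf) (by
    refine (eventually_chart_iff r fun q => y q = 0 → f q = 0).2 ?_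
    filter_upwards [h0, hy.zeros] with q h1 h2 h3 using h1 (h2.2 h3))
  set e := (chartAt E r).symm with he
  have hs : ∀ᶠ x in 𝓝 (chartAt E r r), y (e x) ≠ 0 →
      y (e x) ^ (-(k : ℤ)) • f (e x) = y (e x) ^ (1 - (k : ℤ)) • a x := by
    filter_upwards [hfa] with x h1 h2
    rw [h1, smul_smul, ← zpow_add_one₀ h2]
    congr 2; ring
  have hd : OrdGE (fun x => y (e x)) (-(k : ℤ))
      (fderiv ℂ fun x => y (e x) ^ (-(k : ℤ)) • f (e x)) (chartAt E r r) := by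
    refine ⟨fun x => y (e x) • fderiv ℂ a x +
      ((1 - (k : ℂ)) • fderiv ℂ (fun x => y (e x)) x).smulRight (a x), ?_, ?_⟩
    · have h1 : AnalyticAt ℂ (fun x => (1 - (k : ℂ)) • fderiv ℂ (fun x => y (e x)) x)
          (chartAt E r r) := AnalyticAt.fun_smul analyticAt_const hye.analyticAt.fderiv
      exact (AnalyticAt.fun_smul hye.analyticAt ha.fderiv).add
        (((ContinuousLinearMap.smulRightL ℂ E ℂ).analyticAt_bilinear _).comp₂ h1 ha)
    · filter_upwards [hye.eventually_eventuallyEq hs, hye.analyticAt.eventually_analyticAt,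
        ha.eventually_analyticAt] with x h1 h2 h3 h4
      rw [(h1 h4).fderiv_eq, (HasFDerivAt.zpow_smul h2.differentiableAt.hasFDerivAt
        h3.differentiableAt.hasFDerivAt h4 _).fderiv]
      have e1 : (1 - (k : ℤ)) = -(k : ℤ) + 1 := by ring
      have e2 : (1 - (k : ℤ)) - 1 = -(k : ℤ) := by ring
      ext u
      simp only [add_apply, smul_apply, smul_eq_mul, ContinuousLinearMap.smulRight_apply, e2]
      rw [e1, zpow_add_one₀ h4]
      push_cast
      ring
  refine OrdGE.orderGE (y := y) ?_ hy
  refine ((hβ.mono (m := -(k : ℤ)) (by omega) hye.analyticAt).add hd).congr ?_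
  exact .of_forall fun x _ => sub_add_cancel _ _

/-- A closed formal form with poles of order exactly `k + 1` has a leading coefficient: a nonzero
section `f`, modulo `I ^ k`, of the `k`-th power of the divisor bundle. -/
theorem FormalForm.exists_leading_section (hk : 1 ≤ k) (α : FormalForm E Y (k + 1))
    (hα : α.IsClosed) (hpole : α.HasExactPoleOrder) (D : LineBundle E Y)
    (hD : D.IsDivisorBundle) :
    ∃ (W : Y → Set U) (f : Y → U → ℂ),
      (∀ p, IsOpen (W p) ∧ (p : U) ∈ W p ∧ W p ⊆ D.nhd p) ∧
      (∀ p, ∀ r ∈ W p, HolAt E (f p) r) ∧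
      (∀ p q, ∀ r ∈ Y ∩ W p ∩ W q,
        MemIdealPow E Y k (fun x => f p x - D.g p q x ^ k * f q x) r) ∧
      ∃ p : Y, ¬ ∀ᶠ q in 𝓝 (p : U), q ∈ Y → f p q = 0 := by
  obtain ⟨y, hy, hyg⟩ := hD
  have hyp : ∀ p : Y, IsLocalEquation E Y (y p) p := fun p => hy p p ⟨p.2, D.mem_nhd p⟩
  choose f hf hfp using fun p => α.exists_isPrimitiveAt hα p (hyp p)
  have hev : ∀ p : Y, ∀ᶠ r in 𝓝 (p : U), r ∈ D.nhd p ∧ r ∈ α.nhd k p ∧ HolAt E (f p) r ∧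
      IsPrimitiveAt k (α.form k p) (y p) (f p) r := fun p =>
    ((D.isOpen_nhd p).eventually_mem (D.mem_nhd p)).and
      (((α.isOpen_nhd k p).eventually_mem (α.mem_nhd k p)).and ((hf p).eventually.and (hfp p)))
  choose W hWs hWo hpW using fun p => eventually_nhds_iff.1 (hev p)
  refine ⟨W, f, fun p => ⟨hWo p, hpW p, fun r hr => (hWs p r hr).1⟩,
    fun p r hr => (hWs p r hr).2.2.1, ?_, ?_⟩
  · rintro p q r ⟨⟨hr, hrp⟩, hrq⟩
    obtain ⟨hp1, hp2, hp3, hp4⟩ := hWs p r hrp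
    obtain ⟨hq1, hq2, hq3, hq4⟩ := hWs q r hrq
    refine hp4.memIdealPow hr hq4 ?_ (hy p r ⟨hr, hp1⟩) (hy q r ⟨hr, hq1⟩) hp3 hq3
      (D.hol p q r ⟨⟨hr, hp1⟩, hq1⟩) (hyg p q r ⟨⟨hr, hp1⟩, hq1⟩)
    have h := α.compat k k le_rfl p q r ⟨⟨hr, hp2⟩, hq2⟩
    have e : (k : ℤ) + 1 - ((k + 1 : ℕ) : ℤ) = 0 := by push_cast; ring
    rwa [e] at h
  · obtain ⟨p, hp⟩ := hpole
    refine ⟨p, fun h0 => hp ?_⟩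
    have h1 := ((hfp p).self_of_nhds.orderGE p.2 hk (hyp p) (hf p) h0).ordGE (hyp p) p.2
    have h2 := (α.compat 0 k (Nat.zero_le k) p p p
      ⟨⟨p.2, α.mem_nhd 0 p⟩, α.mem_nhd k p⟩).ordGE (hyp p) p.2
    have e : ((0 : ℕ) : ℤ) + 1 - ((k + 1 : ℕ) : ℤ) = -k := by push_cast; ring
    have e' : 1 - ((k + 1 : ℕ) : ℤ) = -k := by push_cast; ring
    rw [e] at h2
    rw [e']
    refine OrdGE.orderGE (y := y p) ((h2.add h1).congr ?_) (hyp p)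
    exact .of_forall fun x _ => sub_add_cancel _ _

end PolarPart

/-! ### Trivializations on infinitesimal neighbourhoods -/

section Trivialization

variable {E : Type*} [NormedAddCommGroup E] [NormedSpace ℂ E] [CompleteSpace E]
  {U : Type*} [TopologicalSpace U] [ChartedSpace E U] [IsManifold 𝓘(ℂ, E) ω U] {Y : Set U}

theorem memIdealPow_one {f : U → ℂ} {r : U} (hY : IsSmoothHypersurface E Y) (hr : r ∈ Y)
    (hf : HolAt E f r) (h : ∀ᶠ q in 𝓝 r, q ∈ Y → f q = 0) : MemIdealPow E Y 1 f r := by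
  obtain ⟨y, hy⟩ := hY.exists_equation r hr
  obtain ⟨a, ha, hfa⟩ := (hy.isEquationAt hr).exists_eq_smul ((holAt_iff f r).1 hf) (by
    refine (eventually_chart_iff r fun q => y q = 0 → f q = 0).2 ?_
    filter_upwards [h, hy.zeros] with q h1 h2 h3 using h1 (h2.2 h3))
  refine memIdealPow_of_chart hy ha ?_
  filter_upwards [hfa] with x hx
  rw [hx, pow_one, smul_eq_mul]

/-- Triviality on the reduced space `Y` only involves the values of functions at points of `Y`. -/
theorem LineBundle.trivialOn_zero (hY : IsSmoothHypersurface E Y) (L : LineBundle E Y)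
    (W : Y → Set U) (h : Y → U → ℂ)
    (hW : ∀ p, IsOpen (W p) ∧ (p : U) ∈ W p ∧ W p ⊆ L.nhd p)
    (hh : ∀ p, ∀ r ∈ Y ∩ W p, HolAt E (h p) r ∧ h p r ≠ 0)
    (hL : ∀ p q, ∀ r ∈ Y ∩ W p ∩ W q, L.g p q r * h q r = h p r) : L.TrivialOn 0 := by
  refine ⟨W, h, hW, hh, fun p q r ⟨⟨hr, hp⟩, hq⟩ => memIdealPow_one hY hr ?_ ?_⟩
  · exact ContMDiffAt.sub (ContMDiffAt.mul
      (L.hol p q r ⟨⟨hr, (hW p).2.2 hp⟩, (hW q).2.2 hq⟩) (hh q r ⟨hr, hq⟩).1) (hh p r ⟨hr, hp⟩).1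
  · filter_upwards [(hW p).1.mem_nhds hp, (hW q).1.mem_nhds hq] with x h1 h2 h3
    rw [hL p q x ⟨⟨h3, h1⟩, h2⟩, sub_self]

/-- The order of a line bundle divides every exponent for which the power is trivial. -/
theorem LineBundle.orderOnY_dvd (hY : IsSmoothHypersurface E Y) (L : LineBundle E Y) {k : ℕ}
    (hk : 0 < k) (h : (L.pow k).TrivialOn 0) : L.orderOnY ∣ k := by
  set S : Set ℕ := {m : ℕ | 0 < m ∧ (L.pow m).TrivialOn 0} with hS
  have hmem : L.orderOnY ∈ S := Nat.sInf_mem ⟨k, hk, h⟩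
  set m := L.orderOnY with hm
  obtain ⟨hm0, W, a, hW, ha, hga⟩ := hmem
  obtain ⟨W', b, hW', hb, hgb⟩ := h
  by_contra hdvd
  have hpos : 0 < k % m := Nat.pos_of_ne_zero fun h0 => hdvd (Nat.dvd_of_mod_eq_zero h0)
  refine absurd (Nat.sInf_le (s := S) (m := k % m) ⟨hpos, ?_⟩) (not_le.2 (Nat.mod_lt k hm0))
  refine LineBundle.trivialOn_zero hY _ (fun p => W p ∩ W' p)
    (fun p x => b p x * (a p x ^ (k / m))⁻¹)
    (fun p => ⟨(hW p).1.inter (hW' p).1, ⟨(hW p).2.1, (hW' p).2.1⟩, fun x hx => (hW p).2.2 hx.1⟩)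
    (fun p r hr => ?_) (fun p q r hr => ?_)
  · obtain ⟨h1, h2⟩ := ha p r ⟨hr.1, hr.2.1⟩
    obtain ⟨h3, h4⟩ := hb p r ⟨hr.1, hr.2.2⟩
    exact ⟨ContMDiffAt.mul h3 (ContMDiffAt.inv₀ (ContMDiffAt.pow h1 _) (pow_ne_zero _ h2)),
      mul_ne_zero h4 (inv_ne_zero (pow_ne_zero _ h2))⟩
  · obtain ⟨⟨hr, hp, hp'⟩, hq, hq'⟩ := hr
    have h1 : L.g p q r ^ m * a q r = a p r :=
      sub_eq_zero.1 ((hga p q r ⟨⟨hr, hp⟩, hq⟩).apply_eq_zero one_ne_zero hr)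
    have h2 : L.g p q r ^ k * b q r = b p r :=
      sub_eq_zero.1 ((hgb p q r ⟨⟨hr, hp'⟩, hq'⟩).apply_eq_zero one_ne_zero hr)
    have ha0 := (ha q r ⟨hr, hq⟩).2
    have hg0 : L.g p q r ≠ 0 := L.ne_zero p q r ⟨⟨hr, (hW p).2.2 hp⟩, (hW q).2.2 hq⟩
    change L.g p q r ^ (k % m) * (b q r * (a q r ^ (k / m))⁻¹) = b p r * (a p r ^ (k / m))⁻¹
    have h3 : L.g p q r ^ k = (L.g p q r ^ m) ^ (k / m) * L.g p q r ^ (k % m) := by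
      rw [← pow_mul, ← pow_add, Nat.div_add_mod]
    rw [← h1, ← h2, h3, mul_pow]
    field_simp

/-- A trivialization on `Y` of the Ueda bundle extends to the infinitesimal neighbourhood `Y(k - 1)`
as soon as the `k`-th power of the divisor bundle has a nonzero section on this neighbourhood. -/
theorem trivialOn_of_section (hY : IsSmoothHypersurface E Y) (hYc : IsCompact Y)
    (hYi : IsConnected Y) (D F : LineBundle E Y) (hF : F.IsFlatUnitary) (hDF : D.IsoOnY F)
    {k : ℕ} (hk : 1 ≤ k) (W : Y → Set U) (f : Y → U → ℂ)
    (hW : ∀ p, IsOpen (W p) ∧ (p : U) ∈ W p ∧ W p ⊆ D.nhd p)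
    (hf : ∀ p, ∀ r ∈ W p, HolAt E (f p) r)
    (hfg : ∀ p q, ∀ r ∈ Y ∩ W p ∩ W q,
      MemIdealPow E Y k (fun x => f p x - D.g p q x ^ k * f q x) r)
    (hne : ∃ p : Y, ¬ ∀ᶠ q in 𝓝 (p : U), q ∈ Y → f p q = 0) :
    (∀ ℓ, ℓ < k → (uedaBundle D F).TrivialOn ℓ) ∧ (D.pow k).TrivialOn 0 := by
  obtain ⟨V, h, hV, hh, hhg⟩ := hDF
  have hk0 : k ≠ 0 := by omega
  have hkC : (k : ℂ) ≠ 0 := Nat.cast_ne_zero.2 hk0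
  have hVD : ∀ p, V p ⊆ D.nhd p := fun p x hx => ((hV p).2.2 hx).1
  have hVF : ∀ p, V p ⊆ F.nhd p := fun p x hx => ((hV p).2.2 hx).2
  have hF1 : ∀ p q, ∀ r ∈ Y ∩ V p ∩ V q, ‖F.g p q r‖ = 1 ∧ ∀ᶠ x in 𝓝 r, F.g p q x = F.g p q r := by
    rintro p q r ⟨⟨hr, hp⟩, hq⟩
    obtain ⟨c, hc, hFc⟩ := hF p q r ⟨⟨hr, hVF p hp⟩, hVF q hq⟩
    rw [hFc.self_of_nhds]
    exact ⟨hc, hFc⟩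
  have hD0 : ∀ p q, ∀ r ∈ Y ∩ V p ∩ V q, D.g p q r ≠ 0 := fun p q r ⟨⟨hr, hp⟩, hq⟩ =>
    D.ne_zero p q r ⟨⟨hr, hVD p hp⟩, hVD q hq⟩
  -- the values on `Y` of the two sections
  have hfY : ∀ p q, ∀ r ∈ Y ∩ W p ∩ W q, f p r = D.g p q r ^ k * f q r := fun p q r hr =>
    sub_eq_zero.1 ((hfg p q r hr).apply_eq_zero hk0 hr.1.1)
  have hhY : ∀ p q, ∀ r ∈ Y ∩ V p ∩ V q, D.g p q r * (F.g p q r)⁻¹ * h q r = h p r :=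
    fun p q r hr => sub_eq_zero.1 ((hhg p q r hr).apply_eq_zero one_ne_zero hr.1.1)
  -- `φ` is a section of `F ^ k` on `Y`
  set φ : Y → U → ℂ := fun p x => f p x * (h p x ^ k)⁻¹ with hφ
  have hφF : ∀ p q, ∀ r ∈ Y ∩ (V p ∩ W p) ∩ (V q ∩ W q), φ p r = F.g p q r ^ k * φ q r := by
    rintro p q r ⟨⟨hr, hp, hp'⟩, hq, hq'⟩
    have h0 := (hh q r ⟨hr, hq⟩).2
    have hg0 := hD0 p q r ⟨⟨hr, hp⟩, hq⟩
    have hF0 : F.g p q r ≠ 0 := norm_ne_zero_iff.1 (by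
      rw [(hF1 p q r ⟨⟨hr, hp⟩, hq⟩).1]; exact one_ne_zero)
    simp only [hφ]
    rw [hfY p q r ⟨⟨hr, hp'⟩, hq'⟩, ← hhY p q r ⟨⟨hr, hp⟩, hq⟩, mul_pow, mul_pow, inv_pow]
    field_simp
  obtain ⟨C, hC, hloc⟩ := norm_eq_const_of_flat_section hY hYc hYi (fun p => V p ∩ W p)
    (fun p => (hV p).1.inter (hW p).1) (fun p => ⟨(hV p).2.1, (hW p).2.1⟩) φ
    (fun p r ⟨hr, hp, hp'⟩ => ContMDiffAt.mul (hf p r hp') (ContMDiffAt.inv₀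
      (ContMDiffAt.pow (hh p r ⟨hr, hp⟩).1 _) (pow_ne_zero _ (hh p r ⟨hr, hp⟩).2)))
    (fun p q r hr => by
      rw [hφF p q r hr, norm_mul, norm_pow, (hF1 p q r ⟨⟨hr.1.1, hr.1.2.1⟩, hr.2.1⟩).1, one_pow,
        one_mul])
  have hC0 : C ≠ 0 := by
    rintro rfl
    obtain ⟨p, hp⟩ := hne
    refine hp ?_
    filter_upwards [(hV p).1.mem_nhds (hV p).2.1, (hW p).1.mem_nhds (hW p).2.1] with q h1 h2 h3
    have h4 : f p q * (h p q ^ k)⁻¹ = 0 := norm_eq_zero.1 (hC p q ⟨h3, h1, h2⟩)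
    exact (mul_eq_zero.1 h4).resolve_right (inv_ne_zero (pow_ne_zero _ (hh p q ⟨h3, h1⟩).2))
  have hφ0 : ∀ p, ∀ r ∈ Y ∩ (V p ∩ W p), φ p r ≠ 0 := fun p r hr h0 => hC0 (by
    rw [← hC p r hr, h0, norm_zero])
  have hf0 : ∀ p, ∀ r ∈ Y ∩ (V p ∩ W p), f p r ≠ 0 := fun p r hr => left_ne_zero_of_mul (hφ0 p r hr)
  refine ⟨fun ℓ hℓ => ?_, ?_⟩
  · -- neighbourhoods on which `φ p` is constant on `Y`
    have hev : ∀ p : Y, ∀ᶠ x in 𝓝 (p : U), x ∈ V p ∧ x ∈ W p ∧ (x ∈ Y → φ p x = φ p p) :=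
      fun p => ((hV p).1.eventually_mem (hV p).2.1).and (((hW p).1.eventually_mem (hW p).2.1).and
        (hloc p p ⟨p.2, (hV p).2.1, (hW p).2.1⟩))
    choose T hTs hTo hpT using fun p => eventually_nhds_iff.1 (hev p)
    have hκ0 : ∀ p : Y, φ p p ≠ 0 := fun p => hφ0 p p ⟨p.2, (hV p).2.1, (hW p).2.1⟩
    -- the `k`-th root of `f / φ` that extends the values of `h` on `Y`
    set Q : Y → U → ℂ := fun p x => φ p x / φ p p with hQ
    set H : Y → U → ℂ := fun p x => h p x * Complex.exp (Complex.log (Q p x) / k) with hH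
    have hφhol : ∀ p, ∀ r ∈ Y ∩ T p, HolAt E (φ p) r := fun p r ⟨hr, hp⟩ =>
      ContMDiffAt.mul (hf p r (hTs p r hp).2.1) (ContMDiffAt.inv₀
        (ContMDiffAt.pow (hh p r ⟨hr, (hTs p r hp).1⟩).1 _)
        (pow_ne_zero _ (hh p r ⟨hr, (hTs p r hp).1⟩).2))
    have hQ1 : ∀ p, ∀ r ∈ Y ∩ T p, Q p r = 1 := fun p r ⟨hr, hp⟩ => by
      simp only [hQ]
      rw [(hTs p r hp).2.2 hr, div_self (hκ0 p)]
    have hHh : ∀ p, ∀ r ∈ Y ∩ T p, H p r = h p r := fun p r hr => by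
      simp only [hH]
      rw [hQ1 p r hr]; simp
    have hHhol : ∀ p, ∀ r ∈ Y ∩ T p, HolAt E (H p) r := by
      intro p r hr
      have h1 : AnalyticAt ℂ (fun z : ℂ => Complex.exp (Complex.log (z / φ p p) / k)) (φ p r) := by
        have h2 : φ p r / φ p p = 1 := hQ1 p r hr
        have h3 : AnalyticAt ℂ Complex.log (φ p r / φ p p) := by
          rw [h2]; exact analyticAt_clog Complex.one_mem_slitPlane
        have h4 : AnalyticAt ℂ (fun z : ℂ => z / φ p p) (φ p r) :=
          analyticAt_id.div analyticAt_const (hκ0 p)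
        have h5 := AnalyticAt.fun_comp (g := Complex.log) (f := fun z => z / φ p p) h3 h4
        exact (h5.div analyticAt_const hkC).cexp
      have h5 : ContMDiffAt 𝓘(ℂ, ℂ) 𝓘(ℂ, ℂ) ω
          (fun z : ℂ => Complex.exp (Complex.log (z / φ p p) / k)) (φ p r) :=
        h1.contDiffAt.contMDiffAt
      exact ContMDiffAt.mul (hh p r ⟨hr.1, (hTs p r hr.2).1⟩).1 (h5.comp r (hφhol p r hr))
    have hHpow : ∀ p, ∀ r ∈ Y ∩ T p, ∀ᶠ x in 𝓝 r, φ p p * H p x ^ k = f p x := by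
      intro p r hr
      have hpr := hTs p r hr.2
      filter_upwards [(hφhol p r hr).continuousAt.eventually_ne (hφ0 p r ⟨hr.1, hpr.1, hpr.2.1⟩),
        (hh p r ⟨hr.1, hpr.1⟩).1.continuousAt.eventually_ne (hh p r ⟨hr.1, hpr.1⟩).2] with x h1 h2
      have h3 : Q p x ≠ 0 := div_ne_zero h1 (hκ0 p)
      have hκ := hκ0 p
      simp only [hH]
      rw [mul_pow, ← Complex.exp_nat_mul, mul_div_cancel₀ _ hkC, Complex.exp_log h3]
      simp only [hQ]
      rw [mul_left_comm, mul_div_cancel₀ _ hκ]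
      simp only [hφ]
      field_simp
    refine ⟨T, H, fun p => ⟨hTo p, hpT p, fun x hx => (hV p).2.2 (hTs p x hx).1⟩,
      fun p r hr => ⟨hHhol p r hr, ?_⟩, ?_⟩
    · rw [hHh p r hr]
      exact (hh p r ⟨hr.1, (hTs p r hr.2).1⟩).2
    · rintro p q r ⟨⟨hr, hp⟩, hq⟩
      obtain ⟨hpV, hpW, -⟩ := hTs p r hp
      obtain ⟨hqV, hqW, -⟩ := hTs q r hq
      obtain ⟨hc1, hcl⟩ := hF1 p q r ⟨⟨hr, hpV⟩, hqV⟩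
      have hc0 : F.g p q r ≠ 0 := norm_ne_zero_iff.1 (by rw [hc1]; exact one_ne_zero)
      have hκ : φ p p = F.g p q r ^ k * φ q q := by
        rw [← (hTs p r hp).2.2 hr, ← (hTs q r hq).2.2 hr]
        exact hφF p q r ⟨⟨hr, hpV, hpW⟩, hqV, hqW⟩
      have hp0 := hκ0 p
      have hmem : MemIdealPow E Y k
          (fun x => ((uedaBundle D F).g p q x * H q x) ^ k - H p x ^ k) r := by
        refine ((hfg p q r ⟨⟨hr, hpW⟩, hqW⟩).const_mul (-(φ p p)⁻¹)).congr ?_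
        filter_upwards [hHpow p r ⟨hr, hp⟩, hHpow q r ⟨hr, hq⟩, hcl] with x h1 h2 h3
        change -(φ p p)⁻¹ * (f p x - D.g p q x ^ k * f q x) =
          (D.g p q x * (F.g p q x)⁻¹ * H q x) ^ k - H p x ^ k
        have h4 : H p x ^ k = (φ p p)⁻¹ * f p x := by
          rw [← h1, inv_mul_cancel_left₀ hp0]
        have h5 : (φ p p)⁻¹ * f q x = (F.g p q r ^ k)⁻¹ * H q x ^ k := by
          rw [← h2, hκ, mul_inv, mul_assoc, inv_mul_cancel_left₀ (hκ0 q)]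
        rw [h4, h3, mul_pow, mul_pow, inv_pow]
        linear_combination D.g p q x ^ k * h5
      refine (MemIdealPow.sub_of_pow_sub_pow hk0 ?_ (hHhol p r ⟨hr, hp⟩) ?_ ?_ hmem).mono hℓ
      · exact ContMDiffAt.mul ((uedaBundle D F).hol p q r
          ⟨⟨hr, (hV p).2.2 hpV⟩, (hV q).2.2 hqV⟩) (hHhol q r ⟨hr, hq⟩)
      · rw [hHh p r ⟨hr, hp⟩, hHh q r ⟨hr, hq⟩]
        exact hhY p q r ⟨⟨hr, hpV⟩, hqV⟩
      · rw [hHh p r ⟨hr, hp⟩]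
        exact (hh p r ⟨hr, hpV⟩).2
  · refine LineBundle.trivialOn_zero hY _ (fun p => V p ∩ W p) f
      (fun p => ⟨(hV p).1.inter (hW p).1, ⟨(hV p).2.1, (hW p).2.1⟩, fun x hx => hVD p hx.1⟩)
      (fun p r hr => ⟨hf p r hr.2.2, hf0 p r hr⟩) (fun p q r hr => ?_)
    exact (hfY p q r ⟨⟨hr.1.1, hr.1.2.2⟩, hr.2.2⟩).symm

end Trivialization

end Ueda

end

theorem propositionP
    {E : Type*} [NormedAddCommGroup E] [NormedSpace ℂ E] [FiniteDimensional ℂ E]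
    {U : Type*} [TopologicalSpace U] [T2Space U] [ChartedSpace E U] [IsManifold 𝓘(ℂ, E) ω U]
    (Y : Set U) (hY : Ueda.IsSmoothHypersurface E Y) (hYc : IsCompact Y) (hYi : IsConnected Y)
    (D : Ueda.LineBundle E Y) (hD : D.IsDivisorBundle)
    (F : Ueda.LineBundle E Y) (hF : F.IsFlatUnitary) (hDF : D.IsoOnY F)
    (k : ℕ) (hk : 1 ≤ k)
    (α : Ueda.FormalForm E Y (k + 1)) (hα : α.IsClosed) (hpole : α.HasExactPoleOrder) :
    (k : ℕ∞) ≤ Ueda.uedaType D F ∧ D.orderOnY ∣ k := by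
  have : CompleteSpace E := FiniteDimensional.complete ℂ E
  obtain ⟨W, f, hW, hf, hfg, hne⟩ := α.exists_leading_section hk hα hpole D hD
  obtain ⟨htriv, hpow⟩ := Ueda.trivialOn_of_section hY hYc hYi D F hF hDF hk W f hW hf hfg hne
  refine ⟨le_sInf ?_, Ueda.LineBundle.orderOnY_dvd hY D hk hpow⟩
  rintro _ ⟨ℓ, hℓ, rfl⟩
  by_contra hlt
  exact hℓ (htriv ℓ (ENat.natCast_lt_natCast.1 (not_le.1 hlt)))
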